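/- **Conventions.** For a small category $\mathscr C$ consider the conditions: (1) for every morphism $f:\mathtt i\to\mathtt j$ and every monomorphism $\alpha:\mathtt k\to\mathtt j$ the pullback of $\alpha$ along $f$ exists; (2) for all monomorphisms $\alpha:\mathtt i\to\mathtt j$, $\beta:\mathtt j\to\mathtt k$ there are monomorphisms $\gamma:\mathtt i\to\mathtt l$, $\delta:\mathtt l\to\mathtt k$ such that $\delta\gamma=\beta\alpha$ is a pullback square of $\delta$ and $\beta$ (with projections $\gamma$ and $\alpha$), and for all morphisms $\xi:\mathtt m\to\mathtt i$, $\eta:\mathtt m\to\mathtt n$, $\zeta:\mathtt n\to\mathtt k$ for which $\zeta\eta=\beta(\alpha\xi)$ is a pullback square of $\zeta$ and $\beta$ there is $\varphi:\mathtt n\to\mathtt l$ with $\delta\varphi=\zeta$ and $\varphi\eta=\gamma\xi$. (The square $\delta\gamma=\beta\alpha$ is then called a complement diagram.) Let $\mathscr S$ be the category of small categories satisfying (1) and (2), with morphisms all functors that preserve monomorphisms, pullbacks along monomorphisms, and complement diagrams. For $\mathscr C\in\mathscr S$ the category $\mathscr P(\mathscr C)$ has the objects of $\mathscr C$; its morphisms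 $\mathtt i\to\mathtt j$ are the diagrams $\mathtt i\xleftarrow{\alpha}\mathtt k\xrightarrow{f}\mathtt j$ with $\alpha$ a monomorphism, up to isomorphism of $\mathtt k$; they are composed by pullback. Functors are applied to diagrams termwise. This makes $\mathscr P$ an endofunctor of $\mathscr S$, and $\mathscr P^n$ is its $n$-th iterate, $\mathscr P^0=\mathrm{Id}$. Every monomorphism of $\mathscr P^n(\mathscr C)$ comes from one of $\mathscr C$, so the morphisms $\mathtt i\to\mathtt j$ of $\mathscr P^n(\mathscr C)$ are given by diagrams $$\mathtt i=\mathtt k_{n+1}\xleftarrow{\alpha_n}\mathtt k_n\xleftarrow{\alpha_{n-1}}\cdots\xleftarrow{\alpha_1}\mathtt k_1\xrightarrow{f}\mathtt j$$ in $\mathscr C$ with all $\alpha_r$ monomorphisms. For $n\ge1$ and $1\le s\le n+1$ let $\mathfrak f_n^{(s)}$ be the operation that repeats the vertex $\mathtt k_s$ (inserting an identity arrow), and for $n\ge2$ and $2\le s\le n$ let $\mathfrak t_n^{(s)}$ be the operation that removes the vertex $\mathtt k_s$ (composing the two adjacent monomorphisms). Let $\mathscr A$ be the category whose objects are the endofunctors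 $\mathscr P^n$ ($n\ge0$) of $\mathscr S$ and whose morphisms are all natural transformations. Let $\mathscr B$ be the category whose objects are the integers $n\ge1$ and in which $\mathscr B(m,n)$ is the set of order-preserving maps $a:\{1<\dots<n<\infty\}\to\{1<\dots<m<\infty\}$ with $a(1)=1$, $a(\infty)=\infty$; the composite of $a\in\mathscr B(m,n)$ and $b\in\mathscr B(n,p)$ is the map $a\circ b\in\mathscr B(m,p)$. For $n\ge 1$ and $1\le s\le n+1$ let $\varphi_n^{(s)}\in\mathscr B(n,n+1)$ be the map $r\mapsto r$ ($r\le s$, $r\leq n$), $r\mapsto r-1$ ($s<r\le n+1$), $\infty\mapsto\infty$, and, if $s=n+1$, $n+1\mapsto\infty$. For $n\ge2$ and $2\le s\le n$ let $\tau_n^{(s)}\in\mathscr B(n,n-1)$ be the map $r\mapsto r$ ($r<s$), $r\mapsto r+1$ ($s\le r\le n-1$), $\infty\mapsto\infty$. Let $\mathcal O'_n$ be the monoid (under composition of maps) of all order-preserving self-maps of $\{1<\dots<n<\infty\}$ that fix $1$ and $\infty$. **Proposition.** The operations $\mathfrak f_n^{(s)}$ and $\mathfrak t_n^{(s)}$ define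 natural transformations $\mathscr P^n\to\mathscr P^{n+1}$ and $\mathscr P^n\to\mathscr P^{n-1}$ (whose components fix all objects), and the assignment $n\mapsto\mathscr P^n$, $\varphi_n^{(s)}\mapsto\mathfrak f_n^{(s)}$, $\tau_n^{(s)}\mapsto\mathfrak t_n^{(s)}$ extends to a faithful functor $\mathrm F:\mathscr B\to\mathscr A$. Moreover, for every $n\ge1$, $\mathrm{End}_{\mathscr B}(n)$ is, by the identity on underlying maps, isomorphic to the opposite monoid $(\mathcal O'_n)^{\mathrm{op}}$ (that is, to $\mathcal O'_n$ with maps composed from left to right), and for all $\mathscr C\in\mathscr S$ and all objects $\mathtt i$ of $\mathscr P^n(\mathscr C)$ the functor $\mathrm F$ induces a homomorphism from this monoid to the monoid of endomorphisms of the monoid $\mathrm{End}_{\mathscr P^n(\mathscr C)}(\mathtt i)$: $a$ acts by the component at $\mathscr C$ of $\mathrm F(a)$. -/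

import Mathlib

open CategoryTheory CategoryTheory.Limits

universe u

namespace Partialization

section Conditions

variable {C : Type u} [Category.{u} C]

/-- Every monomorphism can be pulled back along every morphism with the same codomain. -/
class HasMonoPullbacks (C : Type u) [Category.{u} C] : Prop where
  exists_isPullback : ∀ {i j k : C} (f : i ⟶ j) (α : k ⟶ j), Mono α →
    ∃ (m : C) (β : m ⟶ i) (g : m ⟶ k), IsPullback β g f α

/-- The square `γ ≫ δ = α ≫ β` is a complement diagram of the composable monomorphisms
`α : i ⟶ j` and `β : j ⟶ k`: it is a pullback of monomorphisms, and every `ζ : n ⟶ k` whose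
pullback along `β` factors through `α` (as `ξ ≫ α`) factors through `δ` compatibly with the rest
of the diagram. In terms of subobjects of `k`, `δ` is the relative pseudocomplement of `i` by `j`,
and it stays so after every change of base. -/
structure IsComplement {i j k l : C} (α : i ⟶ j) (β : j ⟶ k) (γ : i ⟶ l) (δ : l ⟶ k) : Prop where
  mono_left : Mono γ
  mono_right : Mono δ
  isPullback : IsPullback γ α δ β
  exists_lift : ∀ {m n : C} (ξ : m ⟶ i) (η : m ⟶ n) (ζ : n ⟶ k),
    IsPullback η (ξ ≫ α) ζ β → ∃ φ : n ⟶ l, η ≫ φ = ξ ≫ γ ∧ φ ≫ δ = ζ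

/-- Every composable pair of monomorphisms has a complement diagram. -/
class HasComplements (C : Type u) [Category.{u} C] : Prop where
  exists_isComplement : ∀ {i j k : C} (α : i ⟶ j) (β : j ⟶ k), Mono α → Mono β →
    ∃ (l : C) (γ : i ⟶ l) (δ : l ⟶ k), IsComplement α β γ δ

theorem IsComplement.of_iso {i j k l l' : C} {α : i ⟶ j} {β : j ⟶ k} {γ : i ⟶ l} {δ : l ⟶ k}
    (h : IsComplement α β γ δ) (e : l ≅ l') {γ' : i ⟶ l'} {δ' : l' ⟶ k}
    (hγ : γ ≫ e.hom = γ') (hδ : e.hom ≫ δ' = δ) : IsComplement α β γ' δ' := by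
  have hδ' : δ' = e.inv ≫ δ := by rw [← hδ, Iso.inv_hom_id_assoc]
  have h1 := h.mono_left
  have h2 := h.mono_right
  refine ⟨by rw [← hγ]; exact mono_comp _ _, by rw [hδ']; exact mono_comp _ _, ?_, ?_⟩
  · exact h.isPullback.of_iso (Iso.refl _) e (Iso.refl _) (Iso.refl _)
      (by simp [hγ]) (by simp) (by simp [hδ]) (by simp)
  · intro m n ξ η ζ hp
    obtain ⟨φ, h1, h2⟩ := h.exists_lift ξ η ζ hp
    refine ⟨φ ≫ e.hom, ?_, ?_⟩
    · rw [← Category.assoc, h1, Category.assoc, hγ]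
    · rw [Category.assoc, hδ, h2]

/-- Complement diagrams are unique up to isomorphism. -/
theorem IsComplement.exists_iso {i j k l l' : C} {α : i ⟶ j} {β : j ⟶ k}
    {γ : i ⟶ l} {δ : l ⟶ k} {γ' : i ⟶ l'} {δ' : l' ⟶ k}
    (h : IsComplement α β γ δ) (h' : IsComplement α β γ' δ') :
    ∃ e : l ≅ l', γ ≫ e.hom = γ' ∧ e.hom ≫ δ' = δ := by
  have h1 := h.mono_right
  have h2 := h'.mono_right
  obtain ⟨φ, a, b⟩ := h'.exists_lift (𝟙 i) γ δ (by simpa using h.isPullback)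
  obtain ⟨ψ, a', b'⟩ := h.exists_lift (𝟙 i) γ' δ' (by simpa using h'.isPullback)
  refine ⟨⟨φ, ψ, ?_, ?_⟩, by simpa using a, b⟩
  · rw [← cancel_mono δ, Category.assoc, b', b, Category.id_comp]
  · rw [← cancel_mono δ', Category.assoc, b, b', Category.id_comp]

end Conditions

section Construction

variable {C : Type u} [Category.{u} C]

/-- A diagram `i ⟵ dom ⟶ j` whose left leg is a monomorphism. -/
structure Diagram (i j : C) : Type u where
  dom : C
  incl : dom ⟶ i
  map : dom ⟶ j
  mono : Mono incl

/-- Two diagrams are equivalent if they are isomorphic over `i` and `j`. -/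
def Diagram.Equivalent {i j : C} (x y : Diagram i j) : Prop :=
  ∃ γ : x.dom ≅ y.dom, γ.hom ≫ y.incl = x.incl ∧ γ.hom ≫ y.map = x.map

instance Diagram.setoid (i j : C) : Setoid (Diagram i j) where
  r := Diagram.Equivalent
  iseqv :=
    { refl := fun x => ⟨Iso.refl _, by simp, by simp⟩
      symm := by
        rintro x y ⟨γ, h1, h2⟩
        exact ⟨γ.symm, by simp [← h1], by simp [← h2]⟩
      trans := by
        rintro x y z ⟨γ, h1, h2⟩ ⟨δ, h3, h4⟩
        exact ⟨γ ≪≫ δ, by simp [h1, h3], by simp [h2, h4]⟩ }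

/-- The diagram obtained from two composable diagrams and a commutative square between them
whose left side is a monomorphism. -/
def Diagram.paste {i j k m : C} (x : Diagram i j) (y : Diagram j k) (p : m ⟶ x.dom)
    (q : m ⟶ y.dom) (h : IsPullback p q x.map y.incl) : Diagram i k where
  dom := m
  incl := p ≫ x.incl
  map := q ≫ y.map
  mono := by
    have := y.mono
    have := x.mono
    have := h.mono_fst_of_mono
    exact mono_comp _ _

theorem Diagram.paste_equivalent {i j k m m' : C} {x x' : Diagram i j} {y y' : Diagram j k}
    {p : m ⟶ x.dom} {q : m ⟶ y.dom} {p' : m' ⟶ x'.dom} {q' : m' ⟶ y'.dom}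
    (h : IsPullback p q x.map y.incl) (h' : IsPullback p' q' x'.map y'.incl)
    (hx : x ≈ x') (hy : y ≈ y') : x.paste y p q h ≈ x'.paste y' p' q' h' := by
  obtain ⟨γ, a, b⟩ := hx
  obtain ⟨δ, c, d⟩ := hy
  have h2 : IsPullback (p ≫ γ.hom) (q ≫ δ.hom) x'.map y'.incl :=
    h.of_iso (Iso.refl _) γ δ (Iso.refl _) (by simp) (by simp) (by simp [b]) (by simp [c])
  have e1 := h2.isoIsPullback_hom_fst _ _ h'
  have e2 := h2.isoIsPullback_hom_snd _ _ h'
  have f1 : (h2.isoIsPullback _ _ h').hom ≫ p' ≫ x'.incl = p ≫ x.incl := by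
    rw [← Category.assoc, e1, Category.assoc, a]
  have f2 : (h2.isoIsPullback _ _ h').hom ≫ q' ≫ y'.map = q ≫ y.map := by
    rw [← Category.assoc, e2, Category.assoc, d]
  exact ⟨h2.isoIsPullback _ _ h', f1, f2⟩

/-- The objects of the partialization of `C` are the objects of `C`. -/
structure Par (C : Type u) : Type u where
  /-- An object of `C`, as an object of the partialization. -/
  toPar ::
  /-- The underlying object of `C`. -/
  of : C

open Par (toPar)

/-- The morphisms of the partialization: equivalence classes of diagrams. -/
def ParHom (i j : C) : Type u := Quotient (Diagram.setoid i j)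

theorem mono_comp_of_isPullback {d e m i j : C} {α : d ⟶ i} {f : d ⟶ j} (hα : Mono α)
    {β : e ⟶ j} (hβ : Mono β) {p : m ⟶ d} {q : m ⟶ e}
    (h : IsPullback p q f β) : Mono (p ≫ α) := by
  have := h.mono_fst_of_mono
  exact mono_comp _ _

variable [HasMonoPullbacks C]

/-- Composition of diagrams by means of some pullback. -/
noncomputable def Diagram.comp {i j k : C} (x : Diagram i j) (y : Diagram j k) : Diagram i k :=
  have h := HasMonoPullbacks.exists_isPullback x.map y.incl y.mono
  x.paste y h.choose_spec.choose h.choose_spec.choose_spec.choose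
    h.choose_spec.choose_spec.choose_spec

theorem Diagram.comp_equivalent {i j k m : C} (x : Diagram i j) (y : Diagram j k)
    {p : m ⟶ x.dom} {q : m ⟶ y.dom} (h : IsPullback p q x.map y.incl) :
    x.comp y ≈ x.paste y p q h :=
  Diagram.paste_equivalent
    (HasMonoPullbacks.exists_isPullback x.map y.incl y.mono).choose_spec.choose_spec.choose_spec h
    (Setoid.refl _) (Setoid.refl _)

theorem Diagram.comp_congr {i j k : C} (x x' : Diagram i j) (hx : x ≈ x')
    (y y' : Diagram j k) (hy : y ≈ y') : x.comp y ≈ x'.comp y' :=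
  Diagram.paste_equivalent
    (HasMonoPullbacks.exists_isPullback x.map y.incl y.mono).choose_spec.choose_spec.choose_spec
    (HasMonoPullbacks.exists_isPullback x'.map y'.incl y'.mono).choose_spec.choose_spec.choose_spec
    hx hy

noncomputable instance : CategoryStruct.{u} (Par C) where
  Hom i j := ParHom i.of j.of
  id i := Quotient.mk (Diagram.setoid i.of i.of) ⟨i.of, 𝟙 i.of, 𝟙 i.of, inferInstance⟩
  comp x y := Quotient.map₂ Diagram.comp
    Diagram.comp_congr x y

/-- The morphism of the partialization given by the diagram `i ⟵ d ⟶ j`. -/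
def parMk {d i j : C} (α : d ⟶ i) (f : d ⟶ j) (h : Mono α) : toPar i ⟶ toPar j :=
  Quotient.mk (Diagram.setoid i j) ⟨d, α, f, h⟩

theorem parMk_surjective {i j : C} (x : toPar i ⟶ toPar j) :
    ∃ (d : C) (α : d ⟶ i) (f : d ⟶ j) (h : Mono α), x = parMk α f h := by
  obtain ⟨⟨d, α, f, h⟩, rfl⟩ := Quotient.exists_rep x
  exact ⟨d, α, f, h, rfl⟩

theorem parMk_eq_iff {d d' i j : C} {α : d ⟶ i} {f : d ⟶ j} {h : Mono α}
    {α' : d' ⟶ i} {f' : d' ⟶ j} {h' : Mono α'} :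
    parMk α f h = parMk α' f' h' ↔ ∃ γ : d ≅ d', γ.hom ≫ α' = α ∧ γ.hom ≫ f' = f :=
  Quotient.eq (r := Diagram.setoid i j)

theorem parMk_comp {d e m i j k : C} {α : d ⟶ i} {f : d ⟶ j} {hα : Mono α}
    {β : e ⟶ j} {g : e ⟶ k} {hβ : Mono β} {p : m ⟶ d} {q : m ⟶ e}
    (h : IsPullback p q f β) (hm : Mono (p ≫ α)) :
    parMk α f hα ≫ parMk β g hβ = parMk (p ≫ α) (q ≫ g) hm :=
  Quotient.sound (s := Diagram.setoid i k)
    (Diagram.comp_equivalent (⟨d, α, f, hα⟩ : Diagram i j) ⟨e, β, g, hβ⟩ h)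

theorem par_id (i : C) : 𝟙 (toPar i) = parMk (𝟙 i) (𝟙 i) inferInstance := rfl

noncomputable instance : Category.{u} (Par C) where
  id_comp {i j} x := by
    obtain ⟨d, α, f, h, rfl⟩ := parMk_surjective (C := C) x
    have h' : Mono (α ≫ 𝟙 i.of) := by simpa using h
    refine (parMk_comp (IsPullback.of_id_snd (f := α)) h').trans ?_
    exact parMk_eq_iff.2 ⟨Iso.refl _, by simp, by simp⟩
  comp_id {i j} x := by
    obtain ⟨d, α, f, h, rfl⟩ := parMk_surjective (C := C) x
    have h' : Mono (𝟙 d ≫ α) := by simpa using h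
    refine (parMk_comp (hα := h) (hβ := inferInstance)
      (IsPullback.of_id_fst (f := f)) h').trans ?_
    exact parMk_eq_iff.2 ⟨Iso.refl _, by simp, by simp⟩
  assoc {i j k l} x y z := by
    obtain ⟨d, α, f, hα, rfl⟩ := parMk_surjective (C := C) x
    obtain ⟨e, β, g, hβ, rfl⟩ := parMk_surjective (C := C) y
    obtain ⟨c, δ, h, hδ, rfl⟩ := parMk_surjective (C := C) z
    obtain ⟨m, p, q, h1⟩ := HasMonoPullbacks.exists_isPullback f β hβ
    obtain ⟨n, r, s, h2⟩ := HasMonoPullbacks.exists_isPullback g δ hδ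
    have hr : Mono r := h2.mono_fst_of_mono
    obtain ⟨t, a, b, h3⟩ := HasMonoPullbacks.exists_isPullback q r hr
    have ha : Mono a := h3.mono_fst_of_mono
    have h1m := mono_comp_of_isPullback hα hβ h1
    have h2m := mono_comp_of_isPullback hβ hδ h2
    have h4 : IsPullback a (b ≫ s) (q ≫ g) δ := h3.paste_vert h2
    have h5 : IsPullback (a ≫ p) b f (r ≫ β) := h3.paste_horiz h1
    rw [parMk_comp h1 h1m, parMk_comp h2 h2m, parMk_comp h4 (mono_comp _ _),
      parMk_comp h5 (mono_comp_of_isPullback hα h2m h5)]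
    exact parMk_eq_iff.2 ⟨Iso.refl _, by simp, by simp⟩

/-- The canonical inclusion of a category into its partialization. -/
noncomputable def parIncl (C : Type u) [Category.{u} C] [HasMonoPullbacks C] : C ⥤ Par C where
  obj := toPar
  map f := parMk (𝟙 _) f inferInstance
  map_comp f g := by
    refine Eq.symm ((parMk_comp (hα := inferInstance) (hβ := inferInstance)
      (IsPullback.of_id_fst (f := f)) (by simpa using mono_comp (𝟙 _) (𝟙 _))).trans ?_)
    exact parMk_eq_iff.2 ⟨Iso.refl _, by simp, by simp⟩

theorem parIncl_comp_parMk {e m i j k : C} (f : i ⟶ j) {β : e ⟶ j} {g : e ⟶ k} {hβ : Mono β}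
    {p : m ⟶ i} {q : m ⟶ e} (h : IsPullback p q f β) (hp : Mono p) :
    (parIncl C).map f ≫ parMk β g hβ = parMk p (q ≫ g) hp := by
  have hp' : Mono (p ≫ 𝟙 i) := by simpa using hp
  refine (parMk_comp h hp').trans ?_
  exact parMk_eq_iff.2 ⟨Iso.refl _, by simp, by simp⟩

theorem parMk_comp_parIncl {d i j k : C} (α : d ⟶ i) (f : d ⟶ j) (hα : Mono α) (g : j ⟶ k) :
    parMk α f hα ≫ (parIncl C).map g = parMk α (f ≫ g) hα := by
  have h' : Mono (𝟙 d ≫ α) := by simpa using hα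
  refine (parMk_comp (hβ := inferInstance) (IsPullback.of_id_fst (f := f)) h').trans ?_
  exact parMk_eq_iff.2 ⟨Iso.refl _, by simp, by simp⟩

theorem parMk_of_isIso {d i j : C} (α : d ⟶ i) (f : d ⟶ j) (hα : Mono α) [IsIso α] :
    parMk α f hα = (parIncl C).map (inv α ≫ f) :=
  parMk_eq_iff.2 ⟨asIso α, by simp, by simp⟩

theorem parIncl_injective {i j : C} {f g : i ⟶ j}
    (h : (parIncl C).map f = (parIncl C).map g) : f = g := by
  obtain ⟨γ, h1, h2⟩ := parMk_eq_iff.1 h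
  rw [Category.comp_id] at h1
  rw [← h2, h1, Category.id_comp]

/-- A morphism of the partialization with a total composite is total. -/
theorem exists_parIncl_of_comp {i j k : C} (x : toPar i ⟶ toPar j) (y : toPar j ⟶ toPar k)
    (e : i ⟶ k) (h : x ≫ y = (parIncl C).map e) : ∃ f : i ⟶ j, x = (parIncl C).map f := by
  obtain ⟨d, α, f, hα, rfl⟩ := parMk_surjective x
  obtain ⟨c, β, g, hβ, rfl⟩ := parMk_surjective y
  obtain ⟨m, p, q, h1⟩ := HasMonoPullbacks.exists_isPullback f β hβ
  rw [parMk_comp h1 (mono_comp_of_isPullback hα hβ h1)] at h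
  obtain ⟨γ, h2, h3⟩ := parMk_eq_iff.1 h
  have h4 : (γ.inv ≫ p) ≫ α = 𝟙 i := by
    rw [Category.assoc, ← h2, Category.comp_id, Iso.inv_hom_id]
  have : IsSplitEpi α := IsSplitEpi.mk' ⟨_, h4⟩
  have : IsIso α := isIso_of_mono_of_isSplitEpi α
  exact ⟨_, parMk_of_isIso α f hα⟩

theorem mono_parIncl_map {i j : C} (f : i ⟶ j) (hf : Mono f) : Mono ((parIncl C).map f) := by
  constructor
  intro k x y h
  obtain ⟨d, α, a, hα, rfl⟩ := parMk_surjective (i := k.of) (j := i) x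
  obtain ⟨e, β, b, hβ, rfl⟩ := parMk_surjective (i := k.of) (j := i) y
  have h' := (parMk_comp_parIncl α a hα f).symm.trans (h.trans (parMk_comp_parIncl β b hβ f))
  obtain ⟨γ, h1, h2⟩ := parMk_eq_iff.1 h'
  exact parMk_eq_iff.2 ⟨γ, h1, by rw [← cancel_mono f, Category.assoc, h2]⟩

/-- The monomorphisms of the partialization are the images of the monomorphisms. -/
theorem exists_parIncl_of_mono {i j : C} (x : toPar i ⟶ toPar j) (hx : Mono x) :
    ∃ f : i ⟶ j, Mono f ∧ x = (parIncl C).map f := by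
  obtain ⟨d, α, f, hα, rfl⟩ := parMk_surjective x
  have h1 : parMk α α hα ≫ parMk α f hα = 𝟙 (toPar i) ≫ parMk α f hα := by
    have h2 : IsPullback (𝟙 d) (𝟙 d) α α := IsKernelPair.id_of_mono α
    have h' : Mono (𝟙 d ≫ α) := by simpa using hα
    refine (parMk_comp h2 h').trans (Eq.trans ?_ (Category.id_comp _).symm)
    exact parMk_eq_iff.2 ⟨Iso.refl _, by simp, by simp⟩
  rw [cancel_mono, par_id] at h1
  obtain ⟨γ, h2, h3⟩ := parMk_eq_iff.1 h1
  rw [Category.comp_id] at h2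
  have : IsIso α := by rw [← h2]; infer_instance
  have hx' : Mono ((parIncl C).map (inv α ≫ f)) := parMk_of_isIso α f hα ▸ hx
  refine ⟨_, ⟨fun {k} a b h => ?_⟩, parMk_of_isIso α f hα⟩
  apply parIncl_injective
  apply hx'.right_cancellation
  rw [← Functor.map_comp, h, Functor.map_comp]

theorem isPullback_of_mono {D : Type u} [Category.{u} D] {w x y z : D} {a : w ⟶ x} {b : w ⟶ y}
    {f : x ⟶ z} {g : y ⟶ z} (ha : Mono a) (h : a ≫ f = b ≫ g)
    (hl : ∀ (t : D) (c : t ⟶ x) (d : t ⟶ y), c ≫ f = d ≫ g → ∃ e : t ⟶ w, e ≫ a = c ∧ e ≫ b = d) :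
    IsPullback a b f g := by
  refine ⟨⟨h⟩, ⟨PullbackCone.IsLimit.mk h (fun s => (hl s.pt s.fst s.snd s.condition).choose)
    (fun s => (hl s.pt s.fst s.snd s.condition).choose_spec.1)
    (fun s => (hl s.pt s.fst s.snd s.condition).choose_spec.2) ?_⟩⟩
  intro s m h1 _
  rw [← cancel_mono a, h1, (hl s.pt s.fst s.snd s.condition).choose_spec.1]

/-- Pullbacks along monomorphisms in the partialization, in terms of a pullback and a complement
diagram. -/
theorem isPullback_par {i j k l m n : C} {α : k ⟶ i} {f : k ⟶ j} {β : l ⟶ j}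
    {β' : m ⟶ k} {f' : m ⟶ l} {α' : m ⟶ n} {β'' : n ⟶ i} (hα : Mono α) (hβ : Mono β)
    (h : IsPullback β' f' f β) (hc : IsComplement β' α α' β'') :
    IsPullback ((parIncl C).map β'') (parMk α' f' hc.mono_left) (parMk α f hα)
      ((parIncl C).map β) := by
  have hβ' : Mono β' := h.mono_fst_of_mono
  refine isPullback_of_mono (mono_parIncl_map _ hc.mono_right) ?_ ?_
  · rw [parIncl_comp_parMk β'' hc.isPullback hc.mono_left]
    refine Eq.trans ?_ (parMk_comp_parIncl α' f' hc.mono_left β).symm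
    rw [h.w]
  · intro t x z hxz
    obtain ⟨q, μ, d, hμ, rfl⟩ := parMk_surjective (i := t.of) (j := i) x
    obtain ⟨q', ξ, g, hξ, rfl⟩ := parMk_surjective (i := t.of) (j := l) z
    obtain ⟨r, a, b, h1⟩ := HasMonoPullbacks.exists_isPullback d α hα
    have h2 := (parMk_comp h1 (mono_comp_of_isPullback hμ hα h1)).symm.trans
      (hxz.trans (parMk_comp_parIncl ξ g hξ β))
    obtain ⟨γ, h3, h4⟩ := parMk_eq_iff.1 h2
    have h5 : b ≫ f = (γ.hom ≫ g) ≫ β := by rw [Category.assoc, h4]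
    obtain ⟨c, h6, h7⟩ := h.exists_lift b (γ.hom ≫ g) h5
    subst h6
    obtain ⟨φ, h8, h9⟩ := hc.exists_lift c a d h1
    subst h9
    refine ⟨parMk μ φ hμ, parMk_comp_parIncl μ φ hμ β'', ?_⟩
    have h10 : IsPullback a c φ α' :=
      (h1.flip.of_right h8.symm hc.isPullback.flip).flip
    refine (parMk_comp h10 (mono_comp_of_isPullback hμ hc.mono_left h10)).trans ?_
    exact parMk_eq_iff.2 ⟨γ, h3, h7.symm⟩

/-- The canonical inclusion preserves pullbacks along monomorphisms. -/
theorem isPullback_parIncl {i j k m : C} {f : i ⟶ j} {α : k ⟶ j} {β : m ⟶ i} {g : m ⟶ k}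
    (hα : Mono α) (h : IsPullback β g f α) :
    IsPullback ((parIncl C).map β) ((parIncl C).map g) ((parIncl C).map f)
      ((parIncl C).map α) := by
  have hβ : Mono β := h.mono_fst_of_mono
  refine isPullback_of_mono (mono_parIncl_map _ hβ) ?_ ?_
  · rw [← Functor.map_comp, h.w, Functor.map_comp]
  · intro t x z hxz
    obtain ⟨q, μ, d, hμ, rfl⟩ := parMk_surjective (i := t.of) (j := i) x
    obtain ⟨q', ξ, c, hξ, rfl⟩ := parMk_surjective (i := t.of) (j := k) z
    have h2 := (parMk_comp_parIncl μ d hμ f).symm.trans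
      (hxz.trans (parMk_comp_parIncl ξ c hξ α))
    obtain ⟨γ, h3, h4⟩ := parMk_eq_iff.1 h2
    have h5 : d ≫ f = (γ.hom ≫ c) ≫ α := by rw [Category.assoc, h4]
    obtain ⟨e, h6, h7⟩ := h.exists_lift d (γ.hom ≫ c) h5
    refine ⟨parMk μ e hμ, (parMk_comp_parIncl μ e hμ β).trans (by rw [h6]), ?_⟩
    refine (parMk_comp_parIncl μ e hμ g).trans ?_
    exact parMk_eq_iff.2 ⟨γ, h3, h7.symm⟩

/-- The canonical inclusion preserves complement diagrams. -/
theorem isComplement_parIncl {i j k l : C} {α : i ⟶ j} {β : j ⟶ k} {γ : i ⟶ l} {δ : l ⟶ k}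
    (hα : Mono α) (hβ : Mono β) (h : IsComplement α β γ δ) :
    IsComplement ((parIncl C).map α) ((parIncl C).map β) ((parIncl C).map γ)
      ((parIncl C).map δ) := by
  have hγ := mono_parIncl_map _ h.mono_left
  have hδ := mono_parIncl_map _ h.mono_right
  have hαm := mono_parIncl_map _ hα
  refine ⟨hγ, hδ, isPullback_parIncl hβ h.isPullback, ?_⟩
  intro m n ξ η ζ hp
  obtain ⟨r, μ, d, hμ, rfl⟩ := parMk_surjective (i := n.of) (j := k) ζ
  obtain ⟨q, a, e, h1⟩ := HasMonoPullbacks.exists_isPullback d β hβ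
  have ha : Mono a := h1.mono_fst_of_mono
  have h2 : (parIncl C).map (a ≫ μ) ≫ parMk μ d hμ =
      (parIncl C).map e ≫ (parIncl C).map β := by
    have h3 : IsPullback (𝟙 q) a (a ≫ μ) μ := by
      have := IsKernelPair.id_of_mono μ
      simpa using (IsPullback.of_id_snd (f := a)).flip.paste_vert this
    rw [parIncl_comp_parMk _ h3 inferInstance, ← Functor.map_comp, ← h1.w]
    rfl
  obtain ⟨w, hw1, hw2⟩ := hp.exists_lift _ _ h2
  rw [← Category.assoc] at hw2
  obtain ⟨e', he'⟩ := exists_parIncl_of_comp (i := q) (j := i) (k := j) (w ≫ ξ) _ _ hw2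
  have hw3 := (congrArg (· ≫ (parIncl C).map α) he').symm.trans hw2
  have h4 := parIncl_injective (((parIncl C).map_comp e' α).trans hw3)
  subst h4
  obtain ⟨φ, h5, h6⟩ := h.exists_lift e' a d h1
  have h7 : parMk μ φ hμ ≫ (parIncl C).map δ = parMk μ d hμ := by
    rw [parMk_comp_parIncl, h6]
  refine ⟨parMk μ φ hμ, ?_, h7⟩
  refine hδ.right_cancellation _ _ ((Category.assoc _ _ _).trans ?_)
  refine (congrArg (η ≫ ·) h7).trans (hp.w.trans ?_)
  rw [Category.assoc, Category.assoc, ← Functor.map_comp, ← Functor.map_comp, h.isPullback.w]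

instance [HasComplements C] : HasMonoPullbacks (Par C) where
  exists_isPullback {i j k} x b hb := by
    obtain ⟨d, α, f, hα, rfl⟩ := parMk_surjective (i := i.of) (j := j.of) x
    obtain ⟨β, hβ, rfl⟩ := exists_parIncl_of_mono (i := k.of) (j := j.of) b hb
    obtain ⟨m, β', f', h⟩ := HasMonoPullbacks.exists_isPullback f β hβ
    obtain ⟨n, α', β'', hc⟩ := HasComplements.exists_isComplement β' α h.mono_fst_of_mono hα
    exact ⟨_, _, _, isPullback_par hα hβ h hc⟩

instance [HasComplements C] : HasComplements (Par C) where
  exists_isComplement {i j k} a b ha hb := by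
    obtain ⟨α, hα, rfl⟩ := exists_parIncl_of_mono (i := i.of) (j := j.of) a ha
    obtain ⟨β, hβ, rfl⟩ := exists_parIncl_of_mono (i := j.of) (j := k.of) b hb
    obtain ⟨l, γ, δ, h⟩ := HasComplements.exists_isComplement α β hα hβ
    exact ⟨_, _, _, isComplement_parIncl hα hβ h⟩

end Construction

section Functoriality

theorem isPullback_map_of_isPullback_map {C D : Type u} [Category.{u} C] [Category.{u} D]
    (G : C ⥤ D) {p p' x y z : C} {a : p ⟶ x} {b : p ⟶ y} {a' : p' ⟶ x} {b' : p' ⟶ y}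
    {f : x ⟶ z} {g : y ⟶ z} (h : IsPullback a b f g) (h' : IsPullback a' b' f g)
    (hG : IsPullback (G.map a) (G.map b) (G.map f) (G.map g)) :
    IsPullback (G.map a') (G.map b') (G.map f) (G.map g) := by
  refine hG.of_iso (G.mapIso (h.isoIsPullback _ _ h')) (Iso.refl _) (Iso.refl _)
    (Iso.refl _) ?_ ?_ (by simp) (by simp)
  · rw [Functor.mapIso_hom, ← Functor.map_comp, h.isoIsPullback_hom_fst]
    simp
  · rw [Functor.mapIso_hom, ← Functor.map_comp, h.isoIsPullback_hom_snd]
    simp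

theorem isComplement_map_of_isComplement_map {C D : Type u} [Category.{u} C] [Category.{u} D]
    (G : C ⥤ D) {i j k l l' : C} {α : i ⟶ j} {β : j ⟶ k}
    {γ : i ⟶ l} {δ : l ⟶ k} {γ' : i ⟶ l'} {δ' : l' ⟶ k}
    (h : IsComplement α β γ δ) (h' : IsComplement α β γ' δ')
    (hG : IsComplement (G.map α) (G.map β) (G.map γ) (G.map δ)) :
    IsComplement (G.map α) (G.map β) (G.map γ') (G.map δ') := by
  obtain ⟨θ, h2, h3⟩ := h.exists_iso h'
  refine hG.of_iso (G.mapIso θ) ?_ ?_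
  · rw [Functor.mapIso_hom, ← Functor.map_comp, h2]
  · rw [Functor.mapIso_hom, ← Functor.map_comp, h3]

/-- The functors which preserve monomorphisms, pullbacks along monomorphisms and complement
diagrams. -/
structure IsAdmissible {C D : Type u} [Category.{u} C] [Category.{u} D] (F : C ⥤ D) : Prop where
  map_mono : ∀ {i j : C} (f : i ⟶ j), Mono f → Mono (F.map f)
  map_isPullback : ∀ {i j k m : C} {f : i ⟶ j} {α : k ⟶ j} {β : m ⟶ i} {g : m ⟶ k},
    Mono α → IsPullback β g f α → IsPullback (F.map β) (F.map g) (F.map f) (F.map α)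
  map_isComplement : ∀ {i j k l : C} {α : i ⟶ j} {β : j ⟶ k} {γ : i ⟶ l} {δ : l ⟶ k},
    Mono α → Mono β → IsComplement α β γ δ →
      IsComplement (F.map α) (F.map β) (F.map γ) (F.map δ)

theorem isAdmissible_id (C : Type u) [Category.{u} C] : IsAdmissible (𝟭 C) :=
  ⟨fun _ h => h, fun _ h => h, fun _ _ h => h⟩

theorem IsAdmissible.comp {C D E : Type u} [Category.{u} C] [Category.{u} D] [Category.{u} E]
    {F : C ⥤ D} {G : D ⥤ E} (hF : IsAdmissible F) (hG : IsAdmissible G) :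
    IsAdmissible (F ⋙ G) :=
  ⟨fun _ h => hG.map_mono _ (hF.map_mono _ h),
    fun hα h => hG.map_isPullback (hF.map_mono _ hα) (hF.map_isPullback hα h),
    fun hα hβ h => hG.map_isComplement (hF.map_mono _ hα) (hF.map_mono _ hβ)
      (hF.map_isComplement hα hβ h)⟩

theorem isAdmissible_parIncl (C : Type u) [Category.{u} C] [HasMonoPullbacks C] :
    IsAdmissible (parIncl C) :=
  ⟨mono_parIncl_map, isPullback_parIncl, isComplement_parIncl⟩

variable {C D : Type u} [Category.{u} C] [Category.{u} D]

/-- The image of a diagram under a functor which preserves monomorphisms. -/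
def Diagram.mapFunctor {F : C ⥤ D} (hF : IsAdmissible F) {i j : C} (x : Diagram i j) :
    Diagram (F.obj i) (F.obj j) :=
  ⟨F.obj x.dom, F.map x.incl, F.map x.map, hF.map_mono _ x.mono⟩

theorem Diagram.mapFunctor_congr {F : C ⥤ D} (hF : IsAdmissible F) {i j : C}
    (x y : Diagram i j) (h : x ≈ y) : x.mapFunctor hF ≈ y.mapFunctor hF := by
  obtain ⟨γ, h1, h2⟩ := h
  have f1 : (F.mapIso γ).hom ≫ F.map y.incl = F.map x.incl := by
    rw [Functor.mapIso_hom, ← Functor.map_comp, h1]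
  have f2 : (F.mapIso γ).hom ≫ F.map y.map = F.map x.map := by
    rw [Functor.mapIso_hom, ← Functor.map_comp, h2]
  exact ⟨F.mapIso γ, f1, f2⟩

variable [HasMonoPullbacks C] [HasMonoPullbacks D]

open Par (toPar)

/-- The functor between partializations induced by a functor, applied diagram by diagram. -/
noncomputable def parMap {F : C ⥤ D} (hF : IsAdmissible F) : Par C ⥤ Par D where
  obj i := toPar (F.obj i.of)
  map x := Quotient.map (Diagram.mapFunctor hF) (Diagram.mapFunctor_congr hF) x
  map_id i := Quotient.sound (s := Diagram.setoid (F.obj i.of) (F.obj i.of))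
    ⟨Iso.refl (F.obj i.of), (Category.id_comp _).trans (F.map_id i.of).symm,
      (Category.id_comp _).trans (F.map_id i.of).symm⟩
  map_comp {i j k} x y := by
    obtain ⟨d, α, f, hα, rfl⟩ := parMk_surjective (i := i.of) (j := j.of) x
    obtain ⟨e, β, g, hβ, rfl⟩ := parMk_surjective (i := j.of) (j := k.of) y
    obtain ⟨m, p, q, h⟩ := HasMonoPullbacks.exists_isPullback f β hβ
    have h' := hF.map_isPullback hβ h
    have hm := mono_comp_of_isPullback (hF.map_mono _ hα) (hF.map_mono _ hβ) h'
    refine (congrArg _ (parMk_comp h (mono_comp_of_isPullback hα hβ h))).trans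
      (Eq.trans ?_ (parMk_comp (hα := hF.map_mono _ hα) (hβ := hF.map_mono _ hβ) h' hm).symm)
    exact parMk_eq_iff.2 ⟨Iso.refl _, (Category.id_comp _).trans (F.map_comp _ _).symm,
      (Category.id_comp _).trans (F.map_comp _ _).symm⟩

theorem parMap_parMk {F : C ⥤ D} (hF : IsAdmissible F) {d i j : C} (α : d ⟶ i) (f : d ⟶ j)
    (hα : Mono α) : (parMap hF).map (parMk α f hα) =
      parMk (F.map α) (F.map f) (hF.map_mono _ hα) := rfl

theorem parMap_parIncl {F : C ⥤ D} (hF : IsAdmissible F) {i j : C} (f : i ⟶ j) :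
    (parMap hF).map ((parIncl C).map f) = (parIncl D).map (F.map f) :=
  parMk_eq_iff.2 ⟨Iso.refl _, (Category.id_comp _).trans (F.map_id _).symm, Category.id_comp _⟩

theorem isAdmissible_parMap [HasComplements C] {F : C ⥤ D} (hF : IsAdmissible F) :
    IsAdmissible (parMap hF) where
  map_mono {i j} x hx := by
    obtain ⟨f, hf, rfl⟩ := exists_parIncl_of_mono (i := i.of) (j := j.of) x hx
    have h := mono_parIncl_map _ (hF.map_mono _ hf)
    rwa [← parMap_parIncl hF] at h
  map_isPullback {i j k w x b c y} hb h := by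
    obtain ⟨d, α, f, hα, rfl⟩ := parMk_surjective (i := i.of) (j := j.of) x
    obtain ⟨β, hβ, rfl⟩ := exists_parIncl_of_mono (i := k.of) (j := j.of) b hb
    obtain ⟨m, β', f', h1⟩ := HasMonoPullbacks.exists_isPullback f β hβ
    obtain ⟨n, α', β'', hc⟩ := HasComplements.exists_isComplement β' α h1.mono_fst_of_mono hα
    have h2 := isPullback_par hα hβ h1 hc
    have hc' := hF.map_isComplement h1.mono_fst_of_mono hα hc
    have h3 := isPullback_par (hF.map_mono _ hα) (hF.map_mono _ hβ)
      (hF.map_isPullback hβ h1) hc'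
    rw [← parMap_parIncl hF, ← parMap_parIncl hF, ← parMap_parMk hF α f hα,
      ← parMap_parMk hF α' f' hc.mono_left] at h3
    exact isPullback_map_of_isPullback_map (parMap hF) h2 h h3
  map_isComplement {i j k l a b c e} ha hb h := by
    obtain ⟨α, hα, rfl⟩ := exists_parIncl_of_mono (i := i.of) (j := j.of) a ha
    obtain ⟨β, hβ, rfl⟩ := exists_parIncl_of_mono (i := j.of) (j := k.of) b hb
    obtain ⟨n, γ, δ, h1⟩ := HasComplements.exists_isComplement α β hα hβ
    have h4 := isComplement_parIncl (hF.map_mono _ hα) (hF.map_mono _ hβ)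
      (hF.map_isComplement hα hβ h1)
    rw [← parMap_parIncl hF, ← parMap_parIncl hF, ← parMap_parIncl hF, ← parMap_parIncl hF] at h4
    exact isComplement_map_of_isComplement_map (parMap hF) (isComplement_parIncl hα hβ h1) h h4

end Functoriality

/-- The small categories in which monomorphisms have pullbacks and composable pairs of
monomorphisms have complement diagrams. -/
structure PCat : Type (u + 1) where
  carrier : Type u
  [category : Category.{u} carrier]
  [hasMonoPullbacks : HasMonoPullbacks carrier]
  [hasComplements : HasComplements carrier]

attribute [instance] PCat.category PCat.hasMonoPullbacks PCat.hasComplements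

instance : CoeSort PCat.{u} (Type u) := ⟨PCat.carrier⟩

/-- The morphisms between such categories: admissible functors. -/
@[ext]
structure PCat.Hom (C D : PCat.{u}) : Type u where
  toFunctor : C ⥤ D
  isAdmissible : IsAdmissible toFunctor

instance : Category.{u} PCat.{u} where
  Hom := PCat.Hom
  id C := ⟨𝟭 C, isAdmissible_id C⟩
  comp F G := ⟨F.toFunctor ⋙ G.toFunctor, F.isAdmissible.comp G.isAdmissible⟩

/-- The partialization functor. -/
noncomputable def partialization : PCat.{u} ⥤ PCat.{u} where
  obj C := ⟨Par C⟩
  map F := ⟨parMap F.isAdmissible, isAdmissible_parMap F.isAdmissible⟩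
  map_id C := by
    refine PCat.Hom.ext (CategoryTheory.Functor.hext (fun _ => rfl) ?_)
    intro i j x
    obtain ⟨d, α, f, hα, rfl⟩ := parMk_surjective (i := i.of) (j := j.of) x
    rfl
  map_comp F G := by
    refine PCat.Hom.ext (CategoryTheory.Functor.hext (fun _ => rfl) ?_)
    intro i j x
    obtain ⟨d, α, f, hα, rfl⟩ := parMk_surjective (i := i.of) (j := j.of) x
    rfl

/-- The iterates of the partialization functor. -/
noncomputable def iter : ℕ → (PCat.{u} ⥤ PCat.{u})
  | 0 => 𝟭 PCat
  | n + 1 => iter n ⋙ partialization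

/-- The canonical inclusion of `C` into the `n`-fold partialization of `C`; it identifies the
objects and the monomorphisms of the two categories. -/
noncomputable def iterIncl (C : PCat.{u}) : (n : ℕ) → (C ⟶ (iter n).obj C)
  | 0 => 𝟙 C
  | n + 1 => ⟨(iterIncl C n).toFunctor ⋙ parIncl ((iter n).obj C),
      (iterIncl C n).isAdmissible.comp (isAdmissible_parIncl _)⟩

/-- The object `i` of `C`, as an object of the `n`-fold partialization of `C`. -/
noncomputable def iterObj (C : PCat.{u}) (n : ℕ) (i : C) : (iter n).obj C :=
  (iterIncl C n).toFunctor.obj i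

/-- The diagrams `i ⟵ k_n ⟵ ⋯ ⟵ k_1 ⟶ j` in which all arrows to the left are monomorphisms.
The constructor `cons` adds the leftmost arrow. -/
inductive Flag (C : Type u) [Category.{u} C] : ℕ → C → C → Type u
  | base {i j : C} (f : i ⟶ j) : Flag C 0 i j
  | cons {n : ℕ} {i k j : C} (α : k ⟶ i) (hα : Mono α) (x : Flag C n k j) : Flag C (n + 1) i j

/-- The morphism of the `n`-fold partialization given by a diagram. -/
noncomputable def Flag.toHom {C : PCat.{u}} :
    {n : ℕ} → {i j : C} → Flag C n i j → (iterObj C n i ⟶ iterObj C n j)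
  | _, _, _, .base f => f
  | _, _, _, .cons (n := n) α hα x =>
    parMk ((iterIncl C n).toFunctor.map α) x.toHom ((iterIncl C n).isAdmissible.map_mono _ hα)

/-- The diagram with the vertex `k_s` repeated, `1 ≤ s ≤ n + 1`, where `k_{n+1} = i`. -/
def Flag.dup {C : Type u} [Category.{u} C] (s : ℕ) :
    {n : ℕ} → {i j : C} → Flag C n i j → Flag C (n + 1) i j
  | _, i, _, .base f => .cons (𝟙 i) inferInstance (.base f)
  | _, i, _, .cons (n := n) α hα x =>
    if s = n + 2 then .cons (𝟙 i) inferInstance (.cons α hα x) else .cons α hα (x.dup s)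

/-- The diagram with the vertex `k_s` removed, `2 ≤ s ≤ n`; the two arrows at `k_s` are
composed. (The length `n` of the given diagram is at least `2`.) -/
def Flag.skip {C : Type u} [Category.{u} C] (s : ℕ) :
    {n : ℕ} → {i j : C} → Flag C (n + 2) i j → Flag C (n + 1) i j
  | 0, _, _, .cons α hα (.cons β hβ x) => .cons (β ≫ α) (mono_comp' hβ hα) x
  | n + 1, _, _, .cons α hα (.cons β hβ x) =>
    if s = n + 3 then .cons (β ≫ α) (mono_comp' hβ hα) x
    else .cons α hα (Flag.skip s (.cons β hβ x))

theorem iterObj_surjective (C : PCat.{u}) (n : ℕ) (d : (iter n).obj C) :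
    ∃ i : C, iterObj C n i = d := by
  induction n with
  | zero => exact ⟨d, rfl⟩
  | succ n ih =>
    obtain ⟨i, hi⟩ := ih d.of
    exact ⟨i, congrArg Par.toPar hi⟩

theorem iterIncl_exists_of_mono (C : PCat.{u}) (n : ℕ) {i j : C}
    (x : iterObj C n i ⟶ iterObj C n j) (hx : Mono x) :
    ∃ f : i ⟶ j, Mono f ∧ x = (iterIncl C n).toFunctor.map f := by
  induction n with
  | zero => exact ⟨x, hx, rfl⟩
  | succ n ih =>
    obtain ⟨y, hy, rfl⟩ := exists_parIncl_of_mono (C := (iter n).obj C) (i := iterObj C n i)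
      (j := iterObj C n j) x hx
    obtain ⟨f, hf, rfl⟩ := ih y hy
    exact ⟨f, hf, rfl⟩

/-- Every morphism of the `n`-fold partialization is given by a diagram. -/
theorem Flag.toHom_surjective (C : PCat.{u}) (n : ℕ) {i j : C}
    (x : iterObj C n i ⟶ iterObj C n j) : ∃ y : Flag C n i j, y.toHom = x := by
  induction n generalizing i with
  | zero => exact ⟨.base x, rfl⟩
  | succ n ih =>
    obtain ⟨d, a, f, ha, rfl⟩ := parMk_surjective (C := (iter n).obj C) (i := iterObj C n i)
      (j := iterObj C n j) x
    obtain ⟨k, rfl⟩ := iterObj_surjective C n d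
    obtain ⟨α, hα, rfl⟩ := iterIncl_exists_of_mono C n a ha
    obtain ⟨y, rfl⟩ := ih f
    exact ⟨.cons α hα y, rfl⟩

/-- A natural transformation between iterates of the partialization functor is given by an
operation on diagrams: on every category it fixes the objects and sends the class of a diagram `x`
to the class of `T x`. -/
def ActsBy {m n : ℕ} (η : iter.{u} m ⟶ iter.{u} n)
    (T : ∀ (C : PCat.{u}) (i j : C), Flag C m i j → Flag C n i j) : Prop :=
  ∀ C : PCat.{u}, ∃ h : ∀ i : C, (η.app C).toFunctor.obj (iterObj C m i) = iterObj C n i,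
    ∀ (i j : C) (x : Flag C m i j), (η.app C).toFunctor.map x.toHom =
      eqToHom (h i) ≫ (T C i j x).toHom ≫ eqToHom (h j).symm

/-- The category of the iterates of the partialization functor and all natural transformations
between them. -/
abbrev Iterates : Type (u + 1) :=
  ObjectProperty.FullSubcategory (fun G : PCat.{u} ⥤ PCat.{u} => ∃ n : ℕ, G = iter n)

/-- The `n`-th iterate, as an object of the category of iterates. -/
noncomputable def Iterates.of (n : ℕ) : Iterates.{u} := ⟨iter n, n, rfl⟩

/-- A natural transformation between iterates, as a morphism of the category of iterates. -/
noncomputable def Iterates.ofHom {m n : ℕ} (η : iter.{u} m ⟶ iter.{u} n) :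
    Iterates.of.{u} m ⟶ Iterates.of n := ObjectProperty.homMk η

/-- The objects of the combinatorial category: the positive integers. -/
structure Comb : Type where
  n : ℕ
  pos : 1 ≤ n

/-- The chain `1 < 2 < ⋯ < n < ∞` is `Fin (n + 1)`, in which `r ∈ {1, …, n}` is written as
`r - 1` and `∞` as `n = Fin.last n` (so, for `n ≥ 1`, the element `1` of the chain is `0`).
A morphism from `m` to `n` is an order-preserving map from the chain of `n` to the chain of `m`
which maps `1` to `1` and `∞` to `∞`; morphisms are composed as maps. -/
instance : Category Comb where
  Hom X Y := {a : Fin (Y.n + 1) →o Fin (X.n + 1) // a 0 = 0 ∧ a (Fin.last Y.n) = Fin.last X.n}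
  id X := ⟨OrderHom.id, rfl, rfl⟩
  comp a b := ⟨a.1.comp b.1, (congrArg a.1 b.2.1).trans a.2.1,
    (congrArg a.1 b.2.2).trans a.2.2⟩

/-- The number `n + 1`, as an object of the combinatorial category. -/
def Comb.succ (n : ℕ) : Comb := ⟨n + 1, Nat.le_add_left 1 n⟩

/-- The map from `{1, …, N + 1, ∞}` to `{1, …, N, ∞}`, `N = n + 1`. For `s ≤ N` it is `r ↦ r` for
`r ≤ s`, `r ↦ r - 1` for `s < r ≤ N + 1`, and `∞ ↦ ∞`; for `s = N + 1` it is `r ↦ r` for `r ≤ N`,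
`N + 1 ↦ ∞`, and `∞ ↦ ∞`. -/
def phiMap (n s : ℕ) (h2 : s ≤ n + 2) : Fin (n + 3) →o Fin (n + 2) where
  toFun x := ⟨if x.1 < s then x.1 else x.1 - 1, by split <;> omega⟩
  monotone' x y h := by
    have h' : x.1 ≤ y.1 := h
    rw [Fin.mk_le_mk]
    split <;> split <;> omega

/-- The map from `{1, …, N - 1, ∞}` to `{1, …, N, ∞}`, `N = n + 2`, with `r ↦ r` for `r < s`,
`r ↦ r + 1` for `s ≤ r ≤ N - 1`, and `∞ ↦ ∞`. -/
def tauMap (n s : ℕ) : Fin (n + 2) →o Fin (n + 3) where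
  toFun x := ⟨if x.1 + 1 < s then x.1 else x.1 + 1, by split <;> omega⟩
  monotone' x y h := by
    have h' : x.1 ≤ y.1 := h
    rw [Fin.mk_le_mk]
    split <;> split <;> omega

/-- The morphism `φ_N^{(s)} : N ⟶ N + 1`, `N = n + 1`, `1 ≤ s ≤ N + 1`. -/
def Comb.phi (n s : ℕ) (h1 : 1 ≤ s) (h2 : s ≤ n + 2) : Comb.succ n ⟶ Comb.succ (n + 1) :=
  ⟨phiMap n s h2, Fin.ext (if_pos (show 0 < s from h1)),
    Fin.ext ((if_neg (show ¬ n + 2 < s by omega)).trans rfl)⟩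

/-- The morphism `τ_N^{(s)} : N ⟶ N - 1`, `N = n + 2`, `2 ≤ s ≤ N`. -/
def Comb.tau (n s : ℕ) (h1 : 2 ≤ s) (h2 : s ≤ n + 2) : Comb.succ (n + 1) ⟶ Comb.succ n :=
  ⟨tauMap n s, Fin.ext (if_pos (show 0 + 1 < s from h1)),
    Fin.ext (if_neg (show ¬ n + 1 + 1 < s by omega))⟩

/-- The monoid of the order-preserving transformations of the chain `1 < 2 < ⋯ < n < ∞` which
fix the endpoints (under composition of maps), a submonoid of the monoid of all order-preserving
transformations. -/
def fixedEnds (n : ℕ) : Submonoid (Fin (n + 1) →o Fin (n + 1)) where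
  carrier := {a | a 0 = 0 ∧ a (Fin.last n) = Fin.last n}
  one_mem' := ⟨rfl, rfl⟩
  mul_mem' {a _} ha hb := ⟨(congrArg a hb.1).trans ha.1, (congrArg a hb.2).trans ha.2⟩

end Partialization

open Partialization

/-!
The partialization functor `P` is a monad. Its unit `C ⟶ P C` is the canonical inclusion, and its
multiplication `P (P C) ⟶ P C` composes the two monomorphisms of a diagram `i ⟵ k₂ ⟵ k₁ ⟶ j`. That
the multiplication is a functor, and an admissible one, reduces to the description of pullbacks
in a partialization by complement diagrams (`isPullback_par`) and to the pasting of complement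
diagrams (`IsComplement.comp`). Repeating or removing a vertex of a diagram is a unit or a
multiplication at some iterate `P^n`, to which `P` is then applied several times (`dupHom`,
`skipHom`).

The monad laws and their consequences need not be checked one by one. Number the vertices of a
diagram `i = k_{n+1} ⟵ ⋯ ⟵ k_1 ⟶ j` from `0` to `n`. The morphism which it gives in `P^n C` depends
only on the vertices as subobjects of `i` and on the class of `i ⟵ k_1 ⟶ j`
(`Flag.toHom_eq_of_invariants`). A natural transformation *realizes* an order-preserving map `a`
fixing the endpoints if it replaces the vertices by those with the indices `a 0, …, a n`, keeps the
class of `i ⟵ k_1 ⟶ j` and is compatible with the inclusions of `C`. Since these data determine the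
transformation, a map has at most one realization (`Realizes.unique`), and realizations compose as
the maps do (`Realizes.comp`). They exist for all maps, as composites of units and multiplications
(`exists_realizes`). This gives the functor, and its values at the maps `φ` and `τ` are the
transformations which repeat or remove a vertex, because these realize `φ` and `τ`.

Faithfulness is seen on the linear order of the natural numbers. There each class contains only
one diagram (`Flag.toHom_injective_of_natCat`), and the vertices of `m ⟵ m - 1 ⟵ ⋯ ⟵ 0 ⟶ 0` are
pairwise distinct subobjects, so a transformation determines the map which it realizes
(`Realizes.map_unique`).
-/

namespace Partialization

open Partialization.Par (toPar)

/-! ### Multiplication on the partialization -/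

section Multiplication

variable {C : Type u} [Category.{u} C]

/-- Complement diagrams can be pasted. In terms of subobjects this is the rule
`c ⇒ (b ⇒ a) = b ⇒ a` for `a ≤ b ≤ c`. -/
theorem IsComplement.comp {a b c d e g : C} {α : a ⟶ b} {β : b ⟶ c} {γ : a ⟶ d} {δ : d ⟶ c}
    {ε : c ⟶ e} {γ' : d ⟶ g} {δ' : g ⟶ e} [HasMonoPullbacks C] (hε : Mono ε)
    (h : IsComplement α β γ δ) (h' : IsComplement δ ε γ' δ') :
    IsComplement α (β ≫ ε) (γ ≫ γ') δ' := by
  have h1 := h.mono_left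
  have h2 := h'.mono_left
  refine ⟨mono_comp _ _, h'.mono_right, ?_, ?_⟩
  · exact h.isPullback.paste_horiz h'.isPullback
  · intro m n ξ η ζ hp
    -- The two lifting properties are applied to the pullback of `ζ` along `ε` and to `ζ` itself.
    obtain ⟨n', p, q, hq⟩ := HasMonoPullbacks.exists_isPullback ζ ε hε
    have hw : η ≫ ζ = ((ξ ≫ α) ≫ β) ≫ ε := by simp [hp.w]
    obtain ⟨r, hr1, hr2⟩ := hq.exists_lift _ _ hw
    have hp' : IsPullback r (ξ ≫ α) q β := by
      subst hr1
      exact hp.of_right hr2 hq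
    obtain ⟨φ, hφ1, hφ2⟩ := h.exists_lift ξ r q hp'
    subst hφ2
    obtain ⟨ψ, hψ1, hψ2⟩ := h'.exists_lift φ p ζ hq
    refine ⟨ψ, ?_, hψ2⟩
    rw [← hr1, Category.assoc, hψ1, ← Category.assoc, hφ1, Category.assoc]

variable [HasMonoPullbacks C]

theorem parIncl_comp_parMk_self {d i j : C} (α : d ⟶ i) (f : d ⟶ j) (hα : Mono α) :
    (parIncl C).map α ≫ parMk α f hα = (parIncl C).map f := by
  have := IsKernelPair.id_of_mono α
  rw [parIncl_comp_parMk α this inferInstance, Category.id_comp]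
  rfl

theorem parMk_id_comp_parMk {d e i j : C} (α : d ⟶ i) (hα : Mono α) (β : e ⟶ d) (f : e ⟶ j)
    (hβ : Mono β) :
    parMk α (𝟙 d) hα ≫ parMk β f hβ = parMk (β ≫ α) f (mono_comp' hβ hα) := by
  refine (parMk_comp (IsPullback.of_id_snd (f := β)) (mono_comp' hβ hα)).trans ?_
  exact parMk_eq_iff.2 ⟨Iso.refl _, by simp, by simp⟩

/-- Every isomorphism of the partialization is the image of an isomorphism. -/
theorem exists_iso_of_parIso {i j : C} (γ : toPar i ≅ toPar j) :
    ∃ g : i ≅ j, γ.hom = (parIncl C).map g.hom := by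
  obtain ⟨g, -, h⟩ := exists_parIncl_of_mono γ.hom inferInstance
  obtain ⟨g', -, h'⟩ := exists_parIncl_of_mono γ.inv inferInstance
  refine ⟨⟨g, g', parIncl_injective ?_, parIncl_injective ?_⟩, h⟩
  · refine ((parIncl C).map_comp _ _).trans (Eq.trans ?_ ((parIncl C).map_id _).symm)
    exact (congrArg₂ (· ≫ ·) h.symm h'.symm).trans γ.hom_inv_id
  · refine ((parIncl C).map_comp _ _).trans (Eq.trans ?_ ((parIncl C).map_id _).symm)
    exact (congrArg₂ (· ≫ ·) h'.symm h.symm).trans γ.inv_hom_id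

/-- The morphism of the partialization given by a diagram in the partialization. The left leg of
the diagram comes from a monomorphism of `C`; the morphism is the partial inverse of this
monomorphism, followed by the right leg. -/
noncomputable def Diagram.flatten {i j : Par C} (x : Diagram i j) : i ⟶ j :=
  have h := exists_parIncl_of_mono (i := x.dom.of) (j := i.of) x.incl x.mono
  parMk h.choose (𝟙 _) h.choose_spec.1 ≫ x.map

/-- The morphism assigned to a diagram in the partialization does not change under an isomorphism
of diagrams in the partialization. -/
theorem parMk_id_comp_eq_of_iso {d d' i j : C} {α : d ⟶ i} (hα : Mono α) {α' : d' ⟶ i}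
    (hα' : Mono α') {f : toPar d ⟶ toPar j} {f' : toPar d' ⟶ toPar j} (γ : toPar d ≅ toPar d')
    (h : γ.hom ≫ (parIncl C).map α' = (parIncl C).map α) (h' : γ.hom ≫ f' = f) :
    parMk α (𝟙 d) hα ≫ f = parMk α' (𝟙 d') hα' ≫ f' := by
  obtain ⟨g, hg⟩ := exists_iso_of_parIso γ
  have e : parMk α (𝟙 d) hα ≫ γ.hom = parMk α' (𝟙 d') hα' := by
    rw [hg]
    refine (parMk_comp_parIncl α (𝟙 d) hα g.hom).trans ?_
    refine parMk_eq_iff.2 ⟨g, parIncl_injective ?_, by simp⟩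
    refine ((parIncl C).map_comp _ _).trans (Eq.trans ?_ h)
    exact congrArg (· ≫ (parIncl C).map α') hg.symm
  rw [← h', ← Category.assoc, e]

theorem Diagram.flatten_congr {i j : Par C} (x y : Diagram i j) (h : x ≈ y) :
    x.flatten = y.flatten := by
  obtain ⟨γ, h1, h2⟩ := h
  have hx := exists_parIncl_of_mono (i := x.dom.of) (j := i.of) x.incl x.mono
  have hy := exists_parIncl_of_mono (i := y.dom.of) (j := i.of) y.incl y.mono
  refine parMk_id_comp_eq_of_iso hx.choose_spec.1 hy.choose_spec.1 γ ?_ h2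
  exact (congrArg (γ.hom ≫ ·) hy.choose_spec.2).symm.trans (h1.trans hx.choose_spec.2)

variable [HasComplements C]

/-- The effect of the multiplication of the partialization monad on morphisms: the diagram
`i ⟵ k₂ ⟵ k₁ ⟶ j` is sent to `i ⟵ k₁ ⟶ j`. -/
noncomputable def mulMap {i j : Par (Par C)} (x : i ⟶ j) : i.of ⟶ j.of :=
  Quotient.lift (s := Diagram.setoid i.of j.of) Diagram.flatten Diagram.flatten_congr x

theorem mulMap_parMk {d i j : C} (α : d ⟶ i) (hα : Mono α) (f : toPar d ⟶ toPar j)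
    (h : Mono ((parIncl C).map α)) :
    mulMap (parMk ((parIncl C).map α) f h) = parMk α (𝟙 d) hα ≫ f := by
  have hx := exists_parIncl_of_mono ((parIncl C).map α) h
  refine parMk_id_comp_eq_of_iso hx.choose_spec.1 hα (Iso.refl _) ?_ (Category.id_comp _)
  exact (Category.id_comp _).trans hx.choose_spec.2

theorem mulMap_parMk_parMk {d e i j : C} (α : d ⟶ i) (hα : Mono α) (β : e ⟶ d) (hβ : Mono β)
    (f : e ⟶ j) (h : Mono ((parIncl C).map α)) :
    mulMap (parMk ((parIncl C).map α) (parMk β f hβ) h) = parMk (β ≫ α) f (mono_comp' hβ hα) := by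
  rw [mulMap_parMk α hα, parMk_id_comp_parMk]

/-- A morphism of the double partialization is given by a diagram `i ⟵ d ⟵ e ⟶ j`. -/
theorem exists_parMk_parMk {i j : C} (x : toPar (toPar i) ⟶ toPar (toPar j)) :
    ∃ (d e : C) (α : d ⟶ i) (hα : Mono α) (β : e ⟶ d) (hβ : Mono β) (f : e ⟶ j),
      x = parMk ((parIncl C).map α) (parMk β f hβ) (mono_parIncl_map α hα) := by
  obtain ⟨d, a, f, ha, rfl⟩ := parMk_surjective x
  obtain ⟨α, hα, rfl⟩ := exists_parIncl_of_mono (i := d.of) a ha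
  obtain ⟨e, β, g, hβ, rfl⟩ := parMk_surjective (i := d.of) f
  exact ⟨_, _, α, hα, β, hβ, g, rfl⟩

variable (C) in
/-- The multiplication of the partialization monad, as a functor. It respects composition because
the pullback of `g` along a partial morphism `d ⟵ e ⟶ j` is formed by a pullback and a complement
diagram, and the latter is a commutative square. -/
noncomputable def mulFunctor : Par (Par C) ⥤ Par C where
  obj i := i.of
  map x := mulMap x
  map_id i := by
    refine (mulMap_parMk_parMk (𝟙 i.of.of) inferInstance (𝟙 i.of.of) inferInstance (𝟙 _)
      inferInstance).trans ?_
    exact parMk_eq_iff.2 ⟨Iso.refl _, by simp, by simp⟩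
  map_comp {i j k} x y := by
    obtain ⟨d, e, α, hα, β, hβ, f, rfl⟩ := exists_parMk_parMk (i := i.of.of) (j := j.of.of) x
    obtain ⟨d', g, v, hg, rfl⟩ : ∃ (d' : C) (g : d' ⟶ j.of.of) (v : toPar d' ⟶ k.of)
        (hg : Mono g), y = parMk ((parIncl C).map g) v (mono_parIncl_map g hg) := by
      obtain ⟨d, a, f, ha, rfl⟩ := parMk_surjective (i := j.of) (j := k.of) y
      obtain ⟨α, hα, rfl⟩ := exists_parIncl_of_mono (i := d.of) (j := j.of.of) a ha
      exact ⟨_, α, f, hα, rfl⟩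
    obtain ⟨m, g', f', h⟩ := HasMonoPullbacks.exists_isPullback f g hg
    obtain ⟨n, β', g'', hc⟩ := HasComplements.exists_isComplement g' β h.mono_fst_of_mono hβ
    have hp := isPullback_par hβ hg h hc
    have hg'' := hc.mono_right
    have hβ' := hc.mono_left
    have hm : Mono ((parIncl C).map g'' ≫ (parIncl C).map α) := by
      rw [← Functor.map_comp]
      exact mono_parIncl_map _ (mono_comp _ _)
    have hm' : Mono (g'' ≫ α) := mono_comp _ _
    have hmf := mono_comp_of_isPullback hβ hg h
    have e1 := parMk_comp (hα := mono_parIncl_map α hα) (hβ := mono_parIncl_map g hg) (g := v)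
      hp hm
    have e2 : parMk ((parIncl C).map g'' ≫ (parIncl C).map α) (parMk β' f' hβ' ≫ v) hm =
        parMk ((parIncl C).map (g'' ≫ α)) (parMk β' f' hβ' ≫ v) (mono_parIncl_map _ hm') :=
      parMk_eq_iff.2 ⟨Iso.refl _, by simp, by simp⟩
    refine (congrArg mulMap (e1.trans e2)).trans ((mulMap_parMk _ hm' _ _).trans ?_)
    refine Eq.trans ?_ (congrArg₂ (· ≫ ·) (mulMap_parMk_parMk α hα β hβ f
      (mono_parIncl_map α hα)) (mulMap_parMk g hg v (mono_parIncl_map g hg))).symm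
    refine Eq.trans (Category.assoc _ _ _).symm (Eq.trans ?_ (Category.assoc _ _ _))
    refine congrArg (· ≫ v) ?_
    refine (parMk_id_comp_parMk (g'' ≫ α) hm' β' f' hβ').trans ?_
    have h3 : Mono (g' ≫ β ≫ α) := by
      rw [← Category.assoc]
      exact mono_comp _ _
    refine Eq.trans ?_ (parMk_comp h h3).symm
    exact parMk_eq_iff.2 ⟨Iso.refl _, by simp [← hc.isPullback.w_assoc], by simp⟩

theorem mulFunctor_parIncl_parIncl {i j : C} (f : i ⟶ j) :
    (mulFunctor C).map ((parIncl (Par C)).map ((parIncl C).map f)) = (parIncl C).map f := by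
  refine (mulMap_parMk_parMk (𝟙 i) inferInstance (𝟙 i) inferInstance f inferInstance).trans ?_
  exact parMk_eq_iff.2 ⟨Iso.refl _, by simp, by simp⟩

theorem exists_parIncl_parIncl_of_mono {i j : C} (x : toPar (toPar i) ⟶ toPar (toPar j))
    (hx : Mono x) : ∃ f : i ⟶ j, Mono f ∧ x = (parIncl (Par C)).map ((parIncl C).map f) := by
  obtain ⟨y, hy, rfl⟩ := exists_parIncl_of_mono x hx
  obtain ⟨f, hf, rfl⟩ := exists_parIncl_of_mono y hy
  exact ⟨f, hf, rfl⟩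

/-- The multiplication preserves pullbacks along monomorphisms because a pullback in the double
partialization is formed by two successive complement diagrams, which paste to the complement
diagram of the composite. -/
theorem isAdmissible_mulFunctor : IsAdmissible (mulFunctor C) where
  map_mono {i j} x hx := by
    obtain ⟨f, hf, rfl⟩ := exists_parIncl_parIncl_of_mono (i := i.of.of) (j := j.of.of) x hx
    have := mono_parIncl_map _ hf
    rwa [← mulFunctor_parIncl_parIncl] at this
  map_isPullback {i j k w x b c y} hb h := by
    obtain ⟨d, e, α, hα, β, hβ, f, rfl⟩ := exists_parMk_parMk (i := i.of.of) (j := j.of.of) x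
    obtain ⟨g, hg, rfl⟩ := exists_parIncl_parIncl_of_mono (i := k.of.of) (j := j.of.of) b hb
    obtain ⟨m, g', f', h1⟩ := HasMonoPullbacks.exists_isPullback f g hg
    have hg' : Mono g' := h1.mono_fst_of_mono
    obtain ⟨n, β', g'', hc⟩ := HasComplements.exists_isComplement g' β hg' hβ
    have hg'' := hc.mono_right
    obtain ⟨l, γ, δ, hc'⟩ := HasComplements.exists_isComplement g'' α hg'' hα
    have h2 := isPullback_par (mono_parIncl_map α hα) (mono_parIncl_map g hg)
      (isPullback_par hβ hg h1 hc) (isComplement_parIncl hg'' hα hc')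
    have h3 := isPullback_par (mono_comp β α) hg h1 (hc.comp hα hc')
    -- It suffices to treat the pullback square constructed by complement diagrams.
    refine isPullback_map_of_isPullback_map (mulFunctor C) h2 h ?_
    have e1 := mulMap_parMk_parMk α hα β hβ f (mono_parIncl_map α hα)
    have e2 := mulMap_parMk_parMk γ hc'.mono_left β' hc.mono_left f'
      (mono_parIncl_map γ hc'.mono_left)
    rw [← e1, ← e2, ← mulFunctor_parIncl_parIncl δ, ← mulFunctor_parIncl_parIncl g] at h3
    exact h3
  map_isComplement {i j k l a b c e} ha hb h := by
    obtain ⟨α, hα, rfl⟩ := exists_parIncl_parIncl_of_mono (i := i.of.of) (j := j.of.of) a ha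
    obtain ⟨β, hβ, rfl⟩ := exists_parIncl_parIncl_of_mono (i := j.of.of) (j := k.of.of) b hb
    obtain ⟨n, γ, δ, h1⟩ := HasComplements.exists_isComplement α β hα hβ
    have h2 := isComplement_parIncl hα hβ h1
    have h3 := isComplement_parIncl (mono_parIncl_map α hα) (mono_parIncl_map β hβ) h2
    refine isComplement_map_of_isComplement_map (mulFunctor C) h3 h ?_
    rw [← mulFunctor_parIncl_parIncl α, ← mulFunctor_parIncl_parIncl β,
      ← mulFunctor_parIncl_parIncl γ, ← mulFunctor_parIncl_parIncl δ] at h2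
    exact h2

end Multiplication

/-! ### Unit and multiplication as natural transformations -/

/-- The unit of the partialization monad: the canonical inclusions. -/
noncomputable def unit : 𝟭 PCat.{u} ⟶ partialization where
  app C := ⟨parIncl C, isAdmissible_parIncl C⟩
  naturality C D F := by
    refine PCat.Hom.ext (CategoryTheory.Functor.hext (fun _ => rfl) ?_)
    intro i j x
    exact heq_of_eq (parMap_parIncl F.isAdmissible x).symm

/-- The multiplication of the partialization monad, as a natural transformation. -/
noncomputable def mul : partialization.{u} ⋙ partialization ⟶ partialization where
  app C := ⟨mulFunctor C, isAdmissible_mulFunctor⟩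
  naturality C D F := by
    refine PCat.Hom.ext (CategoryTheory.Functor.hext (fun _ => rfl) ?_)
    intro i j x
    obtain ⟨d, e, α, hα, β, hβ, f, rfl⟩ := exists_parMk_parMk (C := C) (i := i.of.of)
      (j := j.of.of) x
    have hF := F.isAdmissible
    have e1 := mulMap_parMk_parMk α hα β hβ f (mono_parIncl_map α hα)
    have e2 := mulMap_parMk_parMk (F.toFunctor.map α) (hF.map_mono _ hα) (F.toFunctor.map β)
      (hF.map_mono _ hβ) (F.toFunctor.map f) (mono_parIncl_map _ (hF.map_mono _ hα))
    have e3 : (parMap (isAdmissible_parMap hF)).map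
        (parMk ((parIncl C).map α) (parMk β f hβ) (mono_parIncl_map α hα)) =
        parMk ((parIncl D).map (F.toFunctor.map α)) (parMk (F.toFunctor.map β)
          (F.toFunctor.map f) (hF.map_mono _ hβ)) (mono_parIncl_map _ (hF.map_mono _ hα)) := by
      refine (parMap_parMk _ _ _ _).trans ?_
      exact parMk_eq_iff.2 ⟨Iso.refl _, (Category.id_comp _).trans (parMap_parIncl hF α).symm,
        Category.id_comp _⟩
    refine heq_of_eq ((congrArg mulMap e3).trans (e2.trans ?_))
    refine Eq.trans ?_ (congrArg (parMap hF).map e1).symm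
    exact parMk_eq_iff.2 ⟨Iso.refl _, (Category.id_comp _).trans (F.toFunctor.map_comp β α),
      Category.id_comp _⟩

/-! ### Invariants of diagrams -/

section Invariants

/-- The subobject `k_{r+1}` of the leftmost vertex of a diagram `i ⟵ k_n ⟵ ⋯ ⟵ k_1 ⟶ j`. It is
the whole object for `r = n`, where `k_{n+1} = i`, and by convention for `r > n`. -/
noncomputable def Flag.sub {C : Type u} [Category.{u} C] :
    {n : ℕ} → {i j : C} → Flag C n i j → ℕ → Subobject i
  | _, _, _, .base _, _ => ⊤
  | _, _, _, .cons (n := n) α _ x, r => if r ≤ n then (Subobject.map α).obj (x.sub r) else ⊤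

/-- The morphism `i ⟵ k_1 ⟶ j` of the partialization obtained from a diagram
`i ⟵ k_n ⟵ ⋯ ⟵ k_1 ⟶ j` by composing the arrows to the left. -/
noncomputable def Flag.bot {C : Type u} [Category.{u} C] [HasMonoPullbacks C] :
    {n : ℕ} → {i j : C} → Flag C n i j → (toPar i ⟶ toPar j)
  | _, _, _, .base f => (parIncl C).map f
  | _, _, _, .cons α hα x => parMk α (𝟙 _) hα ≫ x.bot

variable {C : Type u} [Category.{u} C]

theorem Flag.sub_of_le {n r : ℕ} {i j : C} (x : Flag C n i j) (h : n ≤ r) : x.sub r = ⊤ := by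
  cases x with
  | base f => rfl
  | cons α hα x => exact if_neg (by omega)

theorem Flag.sub_cons {n r : ℕ} {i k j : C} (α : k ⟶ i) (hα : Mono α) (x : Flag C n k j)
    (h : r ≤ n) : (Flag.cons α hα x).sub r = (Subobject.map α).obj (x.sub r) :=
  if_pos h

theorem subobject_map_id {i : C} (_ : Mono (𝟙 i)) (x : Subobject i) :
    (Subobject.map (𝟙 i)).obj x = x :=
  Subobject.map_id x

theorem Flag.sub_cons_id {n : ℕ} {i j : C} (h : Mono (𝟙 i)) (x : Flag C n i j) (r : ℕ) :
    (Flag.cons (𝟙 i) h x).sub r = x.sub r := by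
  rcases le_or_gt r n with hr | hr
  · rw [Flag.sub_cons _ _ _ hr, subobject_map_id]
  · rw [Flag.sub_of_le _ hr, Flag.sub_of_le _ hr.le]

theorem Flag.sub_cons_comp {n r : ℕ} {i k l j : C} (α : k ⟶ i) (hα : Mono α) (β : l ⟶ k)
    (hβ : Mono β) (x : Flag C n l j) (h : r ≤ n) :
    (Flag.cons (β ≫ α) (mono_comp' hβ hα) x).sub r =
      (Flag.cons α hα (Flag.cons β hβ x)).sub r := by
  rw [Flag.sub_cons _ _ _ h, Flag.sub_cons _ _ _ (by omega), Flag.sub_cons _ _ _ h,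
    ← Subobject.map_comp]

theorem Flag.sub_dup {n s : ℕ} {i j : C} (x : Flag C n i j) (hs : s ≤ n + 1) (r : ℕ) :
    (x.dup s).sub r = x.sub (if r < s then r else r - 1) := by
  induction x generalizing r with
  | base f => exact Flag.sub_cons_id _ _ _
  | @cons n i k j α hα x ih =>
    rw [Flag.dup]
    split_ifs with h1 h2 h2
    · exact Flag.sub_cons_id _ _ _
    · rw [Flag.sub_of_le _ (by omega), Flag.sub_of_le _ (by omega)]
    · rw [Flag.sub_cons _ _ _ (by omega), Flag.sub_cons _ _ _ (by omega), ih (by omega), if_pos h2]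
    · rcases le_or_gt r (n + 1) with hr | hr
      · rw [Flag.sub_cons _ _ _ hr, Flag.sub_cons _ _ _ (by omega), ih (by omega), if_neg h2]
      · rw [Flag.sub_of_le _ (by omega), Flag.sub_of_le _ (by omega)]

theorem Flag.sub_skip {n s : ℕ} {i j : C} (x : Flag C (n + 2) i j) (h1 : 2 ≤ s) (h2 : s ≤ n + 2)
    (r : ℕ) : (x.skip s).sub r = x.sub (if r + 1 < s then r else r + 1) := by
  induction n generalizing i r with
  | zero =>
    obtain _ | ⟨α, hα, _ | ⟨β, hβ, x⟩⟩ := x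
    rw [Flag.skip]
    split_ifs with h
    · exact Flag.sub_cons_comp _ _ _ _ _ (by omega)
    · rw [Flag.sub_of_le _ (by omega), Flag.sub_of_le _ (by omega)]
  | succ n ih =>
    obtain _ | ⟨α, hα, _ | ⟨β, hβ, x⟩⟩ := x
    rw [Flag.skip]
    split_ifs with h h' h'
    · exact Flag.sub_cons_comp _ _ _ _ _ (by omega)
    · rw [Flag.sub_of_le _ (by omega), Flag.sub_of_le _ (by omega)]
    · rw [Flag.sub_cons _ _ _ (by omega), ih _ (by omega), if_pos h',
        Flag.sub_cons α hα (Flag.cons β hβ x) (by omega)]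
    · rcases le_or_gt r (n + 1) with hr | hr
      · rw [Flag.sub_cons _ _ _ hr, ih _ (by omega), if_neg h',
          Flag.sub_cons α hα (Flag.cons β hβ x) (by omega)]
      · rw [Flag.sub_of_le _ (by omega), Flag.sub_of_le _ (by omega)]

variable [HasMonoPullbacks C]

theorem Flag.bot_cons_id {n : ℕ} {i j : C} (h : Mono (𝟙 i)) (x : Flag C n i j) :
    (Flag.cons (𝟙 i) h x).bot = x.bot :=
  Category.id_comp x.bot

theorem Flag.bot_cons_comp {n : ℕ} {i k l j : C} (α : k ⟶ i) (hα : Mono α) (β : l ⟶ k)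
    (hβ : Mono β) (x : Flag C n l j) :
    (Flag.cons (β ≫ α) (mono_comp' hβ hα) x).bot = (Flag.cons α hα (Flag.cons β hβ x)).bot := by
  change parMk (β ≫ α) (𝟙 l) _ ≫ x.bot = parMk α (𝟙 k) hα ≫ parMk β (𝟙 l) hβ ≫ x.bot
  rw [← parMk_id_comp_parMk α hα β (𝟙 l) hβ, Category.assoc]

theorem Flag.bot_dup {n s : ℕ} {i j : C} (x : Flag C n i j) : (x.dup s).bot = x.bot := by
  induction x with
  | base f => exact Flag.bot_cons_id _ _
  | cons α hα x ih =>
    rw [Flag.dup]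
    split_ifs with h1
    · exact Flag.bot_cons_id _ _
    · exact congrArg (parMk α (𝟙 _) hα ≫ ·) ih

theorem Flag.bot_skip {n s : ℕ} {i j : C} (x : Flag C (n + 2) i j) : (x.skip s).bot = x.bot := by
  induction n generalizing i with
  | zero =>
    obtain _ | ⟨α, hα, _ | ⟨β, hβ, x⟩⟩ := x
    exact Flag.bot_cons_comp _ _ _ _ _
  | succ n ih =>
    obtain _ | ⟨α, hα, _ | ⟨β, hβ, x⟩⟩ := x
    rw [Flag.skip]
    split_ifs with h1
    · exact Flag.bot_cons_comp _ _ _ _ _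
    · exact congrArg (parMk α (𝟙 _) hα ≫ ·) (ih _)

/-- A comparison of two diagrams along an isomorphism of their leftmost vertices. The induction
reconstructs the isomorphisms of the other vertices from the equalities of subobjects. -/
theorem Flag.toHom_eq_comp {C : PCat.{u}} {n : ℕ} {i i' j : C} (x : Flag C n i j)
    (y : Flag C n i' j) (g : i ≅ i')
    (hs : ∀ r ≤ n, (Subobject.map g.hom).obj (x.sub r) = y.sub r)
    (hb : x.bot = (parIncl C).map g.hom ≫ y.bot) :
    x.toHom = (iterIncl C n).toFunctor.map g.hom ≫ y.toHom := by
  induction n generalizing i i' with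
  | zero =>
    obtain f | _ := x
    obtain f' | _ := y
    exact parIncl_injective (hb.trans ((parIncl C).map_comp g.hom f').symm)
  | succ n ih =>
    obtain _ | ⟨α, hα, x⟩ := x
    obtain _ | ⟨β, hβ, y⟩ := y
    rename_i k k'
    have e : Subobject.mk (α ≫ g.hom) = Subobject.mk β := by
      have := hs n (by omega)
      rwa [Flag.sub_cons _ _ _ le_rfl, Flag.sub_cons _ _ _ le_rfl, x.sub_of_le le_rfl,
        y.sub_of_le le_rfl, ← Subobject.map_comp, Subobject.map_top, Subobject.map_top] at this
    -- The subobjects with index `n` provide the isomorphism between the second vertices.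
    let h : k ≅ k' := Subobject.isoOfMkEqMk _ _ e
    have hh : h.hom ≫ β = α ≫ g.hom := by simp [h]
    have key : x.toHom = (iterIncl C n).toFunctor.map h.hom ≫ y.toHom := by
      refine ih x y h ?_ ?_
      · intro r hr
        apply Subobject.map_obj_injective β
        have := hs r (by omega)
        rw [Flag.sub_cons _ _ _ hr, Flag.sub_cons _ _ _ hr, ← Subobject.map_comp] at this
        rw [← this, ← Subobject.map_comp]
        congr 2
      · -- `α` followed by its partial inverse is an identity, so `α` cancels the outer arrow.
        have h1 : (parIncl C).map α ≫ parMk α (𝟙 k) hα ≫ x.bot = (parIncl C).map α ≫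
            (parIncl C).map g.hom ≫ parMk β (𝟙 k') hβ ≫ y.bot :=
          congrArg ((parIncl C).map α ≫ ·) hb
        have h2 : (parIncl C).map α ≫ parMk α (𝟙 k) hα = 𝟙 (toPar k) :=
          parIncl_comp_parMk_self α (𝟙 k) hα
        have h3 : (parIncl C).map β ≫ parMk β (𝟙 k') hβ = 𝟙 (toPar k') :=
          parIncl_comp_parMk_self β (𝟙 k') hβ
        have h4 : (parIncl C).map α ≫ (parIncl C).map g.hom =
            (parIncl C).map h.hom ≫ (parIncl C).map β := by
          rw [← Functor.map_comp, ← Functor.map_comp, hh]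
        have s1 : ((parIncl C).map α ≫ parMk α (𝟙 k) hα) ≫ x.bot = x.bot :=
          (congrArg (· ≫ x.bot) h2).trans (Category.id_comp _)
        have s2 : ((parIncl C).map β ≫ parMk β (𝟙 k') hβ) ≫ y.bot = y.bot :=
          (congrArg (· ≫ y.bot) h3).trans (Category.id_comp _)
        have s3 := h1.trans ((Category.assoc _ _ _).symm.trans
          ((congrArg (· ≫ parMk β (𝟙 k') hβ ≫ y.bot) h4).trans (Category.assoc _ _ _)))
        exact s1.symm.trans ((Category.assoc _ _ _).trans (s3.trans
          (congrArg ((parIncl C).map h.hom ≫ ·) ((Category.assoc _ _ _).symm.trans s2))))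
    have hp : IsPullback ((iterIncl C n).toFunctor.map α) ((iterIncl C n).toFunctor.map h.hom)
        ((iterIncl C n).toFunctor.map g.hom) ((iterIncl C n).toFunctor.map β) := by
      refine IsPullback.of_vert_isIso ⟨?_⟩
      rw [← Functor.map_comp, ← Functor.map_comp, hh]
    change parMk _ x.toHom _ = (parIncl _).map _ ≫ parMk _ y.toHom _
    rw [key]
    exact (parIncl_comp_parMk _ hp ((iterIncl C n).isAdmissible.map_mono _ hα)).symm

/-- The morphism given by a diagram depends only on the subobjects `k_r` of the leftmost vertex
and on the class of the diagram `i ⟵ k_1 ⟶ j`. -/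
theorem Flag.toHom_eq_of_invariants {C : PCat.{u}} {n : ℕ} {i j : C} {x y : Flag C n i j}
    (hs : ∀ r ≤ n, x.sub r = y.sub r) (hb : x.bot = y.bot) : x.toHom = y.toHom := by
  refine (x.toHom_eq_comp y (Iso.refl i) ?_ ?_).trans ?_
  · intro r hr
    exact (subobject_map_id _ _).trans (hs r hr)
  · exact hb.trans ((congrArg (· ≫ y.bot) ((parIncl C).map_id i)).trans (Category.id_comp _)).symm
  · exact (congrArg (· ≫ y.toHom) ((iterIncl C n).toFunctor.map_id i)).trans (Category.id_comp _)

end Invariants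

/-! ### Natural transformations between the iterates -/

section Transformations

/-- The unit of the partialization monad at the `n`-th iterate. -/
noncomputable def unitAt (n : ℕ) : iter.{u} n ⟶ iter (n + 1) where
  app C := unit.app ((iter n).obj C)
  naturality _ _ F := unit.naturality ((iter n).map F)

/-- The multiplication of the partialization monad at the `n`-th iterate. -/
noncomputable def mulAt (n : ℕ) : iter.{u} (n + 2) ⟶ iter (n + 1) where
  app C := mul.app ((iter n).obj C)
  naturality _ _ F := mul.naturality ((iter n).map F)

/-- The partialization functor, applied to a natural transformation between iterates. -/
noncomputable def applyPar {m n : ℕ} (η : iter.{u} m ⟶ iter n) : iter.{u} (m + 1) ⟶ iter (n + 1) :=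
  Functor.whiskerRight η partialization

/-- The natural transformation which repeats the vertex `k_s`. -/
noncomputable def dupHom : (n s : ℕ) → (iter.{u} n ⟶ iter (n + 1))
  | 0, _ => unitAt 0
  | n + 1, s => if s = n + 2 then unitAt (n + 1) else applyPar (dupHom n s)

/-- The natural transformation which removes the vertex `k_s`. -/
noncomputable def skipHom : (n s : ℕ) → (iter.{u} (n + 2) ⟶ iter (n + 1))
  | 0, _ => mulAt 0
  | n + 1, s => if s = n + 3 then mulAt (n + 1) else applyPar (skipHom n s)

/-- A natural transformation between iterates is compatible with the canonical inclusions of a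
category into its iterated partializations. -/
def PreservesIncl {m n : ℕ} (η : iter.{u} m ⟶ iter n) : Prop :=
  ∀ C : PCat.{u}, iterIncl C m ≫ η.app C = iterIncl C n

/-- The natural transformation `η` sends the class of the diagram `x` to the class of `y`. The
equality is heterogeneous, as `η` fixes the objects only up to propositional equality. -/
def SendsTo {m n : ℕ} (η : iter.{u} m ⟶ iter n) {C : PCat.{u}} {i j : C} (x : Flag C m i j)
    (y : Flag C n i j) : Prop :=
  HEq ((η.app C).toFunctor.map x.toHom) y.toHom

theorem PreservesIncl.obj_iterObj {m n : ℕ} {η : iter.{u} m ⟶ iter n} (h : PreservesIncl η)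
    (C : PCat.{u}) (i : C) : (η.app C).toFunctor.obj (iterObj C m i) = iterObj C n i :=
  congrArg (fun F : C ⟶ (iter n).obj C => F.toFunctor.obj i) (h C)

/-- On the morphisms of `C`, and thus on all monomorphisms of the iterate, `η` is the identity. -/
theorem PreservesIncl.map_heq {m n : ℕ} {η : iter.{u} m ⟶ iter n} (h : PreservesIncl η)
    {C : PCat.{u}} {i j : C} (f : i ⟶ j) :
    HEq ((η.app C).toFunctor.map ((iterIncl C m).toFunctor.map f))
      ((iterIncl C n).toFunctor.map f) := by
  have : HEq ((iterIncl C m ≫ η.app C).toFunctor.map f) ((iterIncl C n).toFunctor.map f) := by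
    rw [h C]
  exact this

theorem PreservesIncl.comp {m n p : ℕ} {η : iter.{u} m ⟶ iter n} {θ : iter.{u} n ⟶ iter p}
    (h : PreservesIncl η) (h' : PreservesIncl θ) : PreservesIncl (η ≫ θ) := fun C => by
  rw [NatTrans.comp_app, ← Category.assoc, h C, h' C]

theorem map_heq_map {D E : Type u} [Category.{u} D] [Category.{u} E] (F : D ⥤ E)
    {i i' j j' : D} {f : i ⟶ j} {f' : i' ⟶ j'} (hi : i = i') (hj : j = j') (h : HEq f f') :
    HEq (F.map f) (F.map f') := by
  subst hi hj
  rw [eq_of_heq h]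

theorem parMk_heq_parMk {D : Type u} [Category.{u} D] [HasMonoPullbacks D] {d d' i i' j j' : D}
    {α : d ⟶ i} {α' : d' ⟶ i'} {f : d ⟶ j} {f' : d' ⟶ j'} (h : Mono α) (h' : Mono α')
    (hd : d = d') (hi : i = i') (hj : j = j') (hα : HEq α α') (hf : HEq f f') :
    HEq (parMk α f h) (parMk α' f' h') := by
  subst hd hi hj
  obtain rfl := eq_of_heq hα
  obtain rfl := eq_of_heq hf
  rfl

theorem SendsTo.comp {m n p : ℕ} {η : iter.{u} m ⟶ iter n} {θ : iter.{u} n ⟶ iter p}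
    {C : PCat.{u}} {i j : C} {x : Flag C m i j} {y : Flag C n i j} {z : Flag C p i j}
    (hη : PreservesIncl η) (h : SendsTo η x y) (h' : SendsTo θ y z) : SendsTo (η ≫ θ) x z :=
  (map_heq_map (θ.app C).toFunctor (hη.obj_iterObj C i) (hη.obj_iterObj C j) h).trans h'

theorem preservesIncl_unitAt (n : ℕ) : PreservesIncl (unitAt.{u} n) := fun _ => rfl

theorem sendsTo_unitAt {n : ℕ} {C : PCat.{u}} {i j : C} (x : Flag C n i j) :
    SendsTo (unitAt n) x (.cons (𝟙 i) inferInstance x) :=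
  parMk_heq_parMk _ _ rfl rfl rfl (heq_of_eq ((iterIncl C n).toFunctor.map_id i).symm) HEq.rfl

theorem preservesIncl_mulAt (n : ℕ) : PreservesIncl (mulAt.{u} n) := by
  refine fun C => PCat.Hom.ext (CategoryTheory.Functor.hext (fun _ => rfl) ?_)
  intro i j f
  exact heq_of_eq (mulFunctor_parIncl_parIncl (C := (iter n).obj C)
    ((iterIncl C n).toFunctor.map f))

theorem sendsTo_mulAt {n : ℕ} {C : PCat.{u}} {i k l j : C} (α : k ⟶ i) (hα : Mono α) (β : l ⟶ k)
    (hβ : Mono β) (x : Flag C n l j) :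
    SendsTo (mulAt n) (.cons α hα (.cons β hβ x)) (.cons (β ≫ α) (mono_comp' hβ hα) x) := by
  have hα' := (iterIncl C n).isAdmissible.map_mono _ hα
  have hβ' := (iterIncl C n).isAdmissible.map_mono _ hβ
  refine (heq_of_eq (mulMap_parMk_parMk _ hα' _ hβ' x.toHom (mono_parIncl_map _ hα'))).trans ?_
  exact parMk_heq_parMk _ _ rfl rfl rfl
    (heq_of_eq ((iterIncl C n).toFunctor.map_comp β α).symm) HEq.rfl

theorem PreservesIncl.applyPar {m n : ℕ} {η : iter.{u} m ⟶ iter n} (h : PreservesIncl η) :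
    PreservesIncl (applyPar η) := by
  intro C
  have h1 : iterIncl C (m + 1) ≫ (Partialization.applyPar η).app C =
      iterIncl C m ≫ η.app C ≫ unit.app ((iter n).obj C) :=
    congrArg (iterIncl C m ≫ ·) (unit.naturality (η.app C)).symm
  rw [h1, ← Category.assoc, h C]
  rfl

theorem SendsTo.applyPar {m n : ℕ} {η : iter.{u} m ⟶ iter n} (hη : PreservesIncl η)
    {C : PCat.{u}} {i k j : C} (α : k ⟶ i) (hα : Mono α) {x : Flag C m k j} {y : Flag C n k j}
    (h : SendsTo η x y) : SendsTo (applyPar η) (.cons α hα x) (.cons α hα y) :=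
  parMk_heq_parMk _ _ (hη.obj_iterObj C k) (hη.obj_iterObj C i) (hη.obj_iterObj C j)
    (hη.map_heq α) h

theorem preservesIncl_dupHom (n s : ℕ) : PreservesIncl (dupHom.{u} n s) := by
  induction n with
  | zero => exact preservesIncl_unitAt 0
  | succ n ih =>
    rw [dupHom]
    split_ifs
    · exact preservesIncl_unitAt _
    · exact ih.applyPar

theorem sendsTo_dupHom {n : ℕ} (s : ℕ) {C : PCat.{u}} {i j : C} (x : Flag C n i j) :
    SendsTo (dupHom n s) x (x.dup s) := by
  induction x with
  | base f => exact sendsTo_unitAt _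
  | cons α hα x ih =>
    rw [dupHom, Flag.dup]
    split_ifs
    · exact sendsTo_unitAt _
    · exact ih.applyPar (preservesIncl_dupHom _ _) α hα

theorem preservesIncl_skipHom (n s : ℕ) : PreservesIncl (skipHom.{u} n s) := by
  induction n with
  | zero => exact preservesIncl_mulAt 0
  | succ n ih =>
    rw [skipHom]
    split_ifs
    · exact preservesIncl_mulAt _
    · exact ih.applyPar

theorem sendsTo_skipHom {n : ℕ} (s : ℕ) {C : PCat.{u}} {i j : C} (x : Flag C (n + 2) i j) :
    SendsTo (skipHom n s) x (x.skip s) := by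
  induction n generalizing i with
  | zero =>
    obtain _ | ⟨α, hα, _ | ⟨β, hβ, x⟩⟩ := x
    exact sendsTo_mulAt _ _ _ _ _
  | succ n ih =>
    obtain _ | ⟨α, hα, _ | ⟨β, hβ, x⟩⟩ := x
    rw [skipHom, Flag.skip]
    split_ifs
    · exact sendsTo_mulAt _ _ _ _ _
    · exact (ih _).applyPar (preservesIncl_skipHom _ _) α hα

theorem PreservesIncl.actsBy {m n : ℕ} {η : iter.{u} m ⟶ iter n} (hη : PreservesIncl η)
    {T : ∀ (C : PCat.{u}) (i j : C), Flag C m i j → Flag C n i j}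
    (h : ∀ (C : PCat.{u}) (i j : C) (x : Flag C m i j), SendsTo η x (T C i j x)) : ActsBy η T :=
  fun C => ⟨hη.obj_iterObj C, fun i j x =>
    (conj_eqToHom_iff_heq _ _ _ (hη.obj_iterObj C j)).2 (h C i j x)⟩

end Transformations

/-! ### Maps of chains realized by natural transformations -/

section Realization

/-- The natural transformation `η` realizes the map `a` if it sends the class of a diagram with
the vertices `v_m ⟵ ⋯ ⟵ v_0 ⟶ j` to the class of a diagram with the vertices
`v_{a(n)} ⟵ ⋯ ⟵ v_{a(0)} ⟶ j` (as subobjects of the leftmost one) and with the same class of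
`v_m ⟵ v_0 ⟶ j`. Only the values of `a` at `0, …, n` matter. -/
structure Realizes {m n : ℕ} (a : ℕ → ℕ) (η : iter.{u} m ⟶ iter n) : Prop where
  preservesIncl : PreservesIncl η
  exists_flag : ∀ {C : PCat.{u}} {i j : C} (x : Flag C m i j), ∃ y : Flag C n i j,
    SendsTo η x y ∧ y.bot = x.bot ∧ ∀ r ≤ n, y.sub r = x.sub (a r)

theorem Realizes.congr {m n : ℕ} {a b : ℕ → ℕ} {η : iter.{u} m ⟶ iter n} (h : Realizes a η)
    (hab : ∀ r ≤ n, a r = b r) : Realizes b η :=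
  ⟨h.preservesIncl, fun x => by
    obtain ⟨y, h1, h2, h3⟩ := h.exists_flag x
    exact ⟨y, h1, h2, fun r hr => by rw [h3 r hr, hab r hr]⟩⟩

theorem realizes_id (n : ℕ) : Realizes id (𝟙 (iter.{u} n)) :=
  ⟨fun C => Category.comp_id (iterIncl C n), fun x => ⟨x, HEq.rfl, rfl, fun _ _ => rfl⟩⟩

theorem Realizes.comp {m n p : ℕ} {a b : ℕ → ℕ} {η : iter.{u} m ⟶ iter n}
    {θ : iter.{u} n ⟶ iter p} (hη : Realizes a η) (hθ : Realizes b θ) (hb : ∀ r ≤ p, b r ≤ n) :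
    Realizes (fun r => a (b r)) (η ≫ θ) :=
  ⟨hη.preservesIncl.comp hθ.preservesIncl, fun x => by
    obtain ⟨y, h1, h2, h3⟩ := hη.exists_flag x
    obtain ⟨z, h4, h5, h6⟩ := hθ.exists_flag y
    exact ⟨z, h1.comp hη.preservesIncl h4, h5.trans h2,
      fun r hr => by rw [h6 r hr, h3 _ (hb r hr)]⟩⟩

/-- A map is realized by at most one natural transformation. -/
theorem Realizes.unique {m n : ℕ} {a : ℕ → ℕ} {η θ : iter.{u} m ⟶ iter n} (hη : Realizes a η)
    (hθ : Realizes a θ) : η = θ := by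
  refine NatTrans.ext (funext fun C => PCat.Hom.ext (CategoryTheory.Functor.hext ?_ ?_))
  · intro d
    obtain ⟨i, rfl⟩ := iterObj_surjective C m d
    rw [hη.preservesIncl.obj_iterObj, hθ.preservesIncl.obj_iterObj]
  · intro d e f
    obtain ⟨i, rfl⟩ := iterObj_surjective C m d
    obtain ⟨j, rfl⟩ := iterObj_surjective C m e
    obtain ⟨x, rfl⟩ := Flag.toHom_surjective C m f
    obtain ⟨y, h1, h2, h3⟩ := hη.exists_flag x
    obtain ⟨z, h4, h5, h6⟩ := hθ.exists_flag x
    have : y.toHom = z.toHom :=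
      Flag.toHom_eq_of_invariants (fun r hr => (h3 r hr).trans (h6 r hr).symm) (h2.trans h5.symm)
    exact h1.trans ((heq_of_eq this).trans h4.symm)

theorem realizes_dupHom {n s : ℕ} (hs : s ≤ n + 1) :
    Realizes (fun r => if r < s then r else r - 1) (dupHom.{u} n s) :=
  ⟨preservesIncl_dupHom n s,
    fun x => ⟨x.dup s, sendsTo_dupHom s x, x.bot_dup, fun r _ => x.sub_dup hs r⟩⟩

theorem realizes_skipHom {n s : ℕ} (h1 : 2 ≤ s) (h2 : s ≤ n + 2) :
    Realizes (fun r => if r + 1 < s then r else r + 1) (skipHom.{u} n s) :=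
  ⟨preservesIncl_skipHom n s,
    fun x => ⟨x.skip s, sendsTo_skipHom s x, x.bot_skip, fun r _ => x.sub_skip h1 h2 r⟩⟩

theorem Realizes.applyPar {m n : ℕ} {a : ℕ → ℕ} {η : iter.{u} m ⟶ iter n} (h : Realizes a η)
    (ha : ∀ r ≤ n, a r ≤ m) (ha' : m < a (n + 1)) : Realizes a (applyPar η) := by
  refine ⟨h.preservesIncl.applyPar, fun {C i j} x => ?_⟩
  obtain _ | ⟨α, hα, x⟩ := x
  obtain ⟨y, h1, h2, h3⟩ := h.exists_flag x
  refine ⟨.cons α hα y, h1.applyPar h.preservesIncl α hα,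
    congrArg (parMk α (𝟙 _) hα ≫ ·) h2, fun r hr => ?_⟩
  rcases Nat.lt_or_ge n r with hr' | hr'
  · obtain rfl : r = n + 1 := by omega
    rw [Flag.sub_of_le _ le_rfl, Flag.sub_of_le _ ha']
  · rw [Flag.sub_cons _ _ _ hr', Flag.sub_cons _ _ _ (ha r hr'), h3 r hr']

/-- Every order-preserving map which fixes the endpoints is realized by a composite of units and
multiplications. The value at `n - 1` decides whether the leftmost vertices of a diagram are to
be treated by a unit, by a multiplication, or not at all. -/
theorem exists_realizes (m n : ℕ) (a : ℕ → ℕ) (ha : Monotone a) (h0 : a 0 = 0) (hn : a n = m) :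
    ∃ η : iter.{u} m ⟶ iter n, Realizes a η := by
  obtain ⟨k, hk⟩ : ∃ k, m + n ≤ k := ⟨_, le_rfl⟩
  induction k generalizing m n a with
  | zero =>
    obtain rfl : m = 0 := by omega
    obtain rfl : n = 0 := by omega
    exact ⟨_, (realizes_id 0).congr fun r hr => by rw [Nat.le_zero.1 hr, h0]; rfl⟩
  | succ k ih =>
    obtain _ | n := n
    · obtain rfl : m = 0 := by omega
      exact ⟨_, (realizes_id 0).congr fun r hr => by rw [Nat.le_zero.1 hr, h0]; rfl⟩
    have hle : a n ≤ a (n + 1) := ha (Nat.le_succ n)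
    rcases Nat.lt_trichotomy (a n + 1) m with h | h | h
    · -- The index `m - 1` is not in the image, and the vertex with this index is removed first.
      obtain ⟨m, rfl⟩ : ∃ l, m = l + 2 := ⟨m - 2, by omega⟩
      have hm : Monotone fun r => min (a r) (m + 1) := fun r s hrs => min_le_min_right _ (ha hrs)
      obtain ⟨η, hη⟩ := ih (m + 1) (n + 1) (fun r => min (a r) (m + 1)) hm (by simp [h0])
        (by simp [hn]) (by omega)
      refine ⟨_, ((realizes_skipHom (n := m) (s := m + 2) (by omega) le_rfl).comp hη
        (by simp)).congr fun r hr => ?_⟩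
      rcases Nat.lt_or_ge n r with hr' | hr'
      · obtain rfl : r = n + 1 := by omega
        simp [hn]
      · have := ha hr'
        rw [min_eq_left (by omega), if_pos (by omega)]
    · -- The indices `n` and `m - 1` of the second vertices correspond to each other, so the
      -- leftmost arrow is kept.
      obtain ⟨m, rfl⟩ : ∃ l, m = l + 1 := ⟨m - 1, by omega⟩
      obtain ⟨η, hη⟩ := ih m n a ha h0 (by omega) (by omega)
      exact ⟨_, hη.applyPar (fun r hr => (ha hr).trans (by omega)) (by omega)⟩
    · -- The leftmost vertex is repeated.
      obtain ⟨η, hη⟩ := ih m n a ha h0 (by omega) (by omega)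
      refine ⟨_, (hη.comp (realizes_dupHom (n := n) le_rfl) fun r hr => ?_).congr fun r hr => ?_⟩
      · split_ifs <;> omega
      · split_ifs with h'
        · rfl
        · obtain rfl : r = n + 1 := by omega
          change a n = _
          omega

end Realization

/-! ### Separation of maps by a linear order -/

section Separation

theorem down_le_down_of_hom {i j : ULift.{u} ℕ} (f : i ⟶ j) : i.down ≤ j.down :=
  leOfHom (X := ULift.{u} ℕ) f

/-- The morphism of the linear order of the natural numbers given by an inequality. -/
def homOfDownLe {i j : ULift.{u} ℕ} (h : i.down ≤ j.down) : i ⟶ j :=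
  homOfLE (X := ULift.{u} ℕ) h

/-- The pullbacks of a linear order are the minima. -/
instance : HasMonoPullbacks (ULift.{u} ℕ) where
  exists_isPullback {i _ k} _ _ _ :=
    ⟨⟨min i.down k.down⟩, homOfDownLe (min_le_left _ _), homOfDownLe (min_le_right _ _),
      isPullback_of_mono inferInstance (Subsingleton.elim _ _) fun _ c d _ =>
        ⟨homOfDownLe (le_min (down_le_down_of_hom c) (down_le_down_of_hom d)),
          Subsingleton.elim _ _, Subsingleton.elim _ _⟩⟩

/-- The complement of `i ≤ j ≤ k` is `k` if `i = j`, and `i` otherwise. -/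
instance : HasComplements (ULift.{u} ℕ) where
  exists_isComplement {i j k} α β _ _ := by
    by_cases h : i = j
    · subst h
      refine ⟨k, β, 𝟙 k, inferInstance, inferInstance, ?_, ?_⟩
      · exact isPullback_of_mono inferInstance (Subsingleton.elim _ _) fun _ _ d _ =>
          ⟨d, Subsingleton.elim _ _, Subsingleton.elim _ _⟩
      · exact fun _ _ ζ _ => ⟨ζ, Subsingleton.elim _ _, Subsingleton.elim _ _⟩
    · refine ⟨i, 𝟙 i, α ≫ β, inferInstance, inferInstance, ?_, ?_⟩
      · exact isPullback_of_mono inferInstance (Subsingleton.elim _ _) fun _ c _ _ =>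
          ⟨c, Subsingleton.elim _ _, Subsingleton.elim _ _⟩
      · intro m n ξ η ζ hp
        -- The pullback `m` of `ζ` along `β` is the minimum of `n` and `j`, and `m ≤ i < j`, so that
        -- `m = n`.
        have hij : i.down < j.down :=
          lt_of_le_of_ne (down_le_down_of_hom α) fun e => h (ULift.ext _ _ e)
        have hm : m.down ≤ i.down := down_le_down_of_hom ξ
        have hn : n.down ≤ i.down := by
          by_contra hn
          rcases le_total n.down j.down with hnj | hnj
          · obtain ⟨e, -, -⟩ := hp.exists_lift (𝟙 n) (homOfDownLe hnj) (Subsingleton.elim _ _)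
            have : n.down ≤ m.down := down_le_down_of_hom e
            omega
          · obtain ⟨e, -, -⟩ := hp.exists_lift (homOfDownLe hnj) (𝟙 j) (Subsingleton.elim _ _)
            have : j.down ≤ m.down := down_le_down_of_hom e
            omega
        exact ⟨homOfDownLe hn, Subsingleton.elim _ _, Subsingleton.elim _ _⟩

/-- The linear order of the natural numbers, as a small category with complement diagrams. -/
abbrev natCat : PCat.{u} := ⟨ULift.{u} ℕ⟩

/-- In the linear order of the natural numbers there is at most one diagram in each class. -/
theorem Flag.toHom_injective_of_natCat {n : ℕ} {i j : natCat.{u}} {x y : Flag natCat n i j}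
    (h : x.toHom = y.toHom) : x = y := by
  induction n generalizing i with
  | zero =>
    obtain f | _ := x
    obtain f' | _ := y
    exact congrArg Flag.base h
  | succ n ih =>
    obtain _ | ⟨α, hα, x⟩ := x
    obtain _ | ⟨β, hβ, y⟩ := y
    rename_i k k'
    obtain ⟨γ, -, h2⟩ := parMk_eq_iff.1 h
    obtain ⟨g, -, hg⟩ := iterIncl_exists_of_mono natCat n (i := k) (j := k') γ.hom
      (IsIso.mono_of_iso γ.hom)
    obtain ⟨g', -, -⟩ := iterIncl_exists_of_mono natCat n (i := k') (j := k) γ.inv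
      (IsIso.mono_of_iso γ.inv)
    obtain rfl : k = k' :=
      ULift.ext _ _ (le_antisymm (down_le_down_of_hom g) (down_le_down_of_hom g'))
    obtain rfl : α = β := Subsingleton.elim (α := (k : ULift.{u} ℕ) ⟶ i) _ _
    obtain rfl : g = 𝟙 k := Subsingleton.elim (α := (k : ULift.{u} ℕ) ⟶ k) _ _
    congr 1
    refine ih (h2.symm.trans ?_)
    rw [hg]
    exact (congrArg (· ≫ y.toHom) ((iterIncl natCat n).toFunctor.map_id k)).trans
      (Category.id_comp _)

/-- The diagram `m ⟵ m - 1 ⟵ ⋯ ⟵ 0 ⟶ 0` in the linear order of the natural numbers. -/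
def natFlag : (m : ℕ) → Flag (ULift.{u} ℕ) m ⟨m⟩ ⟨0⟩
  | 0 => .base (𝟙 _)
  | m + 1 => .cons (homOfDownLe (Nat.le_succ m)) inferInstance (natFlag m)

theorem natFlag_sub {m r : ℕ} (h : r ≤ m) :
    (natFlag.{u} m).sub r = Subobject.mk (homOfDownLe (i := ⟨r⟩) (j := ⟨m⟩) h) := by
  induction m with
  | zero =>
    obtain rfl := Nat.le_zero.1 h
    exact (Subobject.mk_eq_top_of_isIso (𝟙 _)).symm
  | succ m ih =>
    rcases Nat.lt_or_ge m r with hr | hr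
    · obtain rfl : r = m + 1 := by omega
      rw [Flag.sub_of_le _ le_rfl]
      exact (Subobject.mk_eq_top_of_isIso (𝟙 _)).symm
    · refine (Flag.sub_cons _ _ _ hr).trans ?_
      rw [ih hr]
      exact Subobject.map_mk _ _

theorem natFlag_sub_injective {m r s : ℕ} (hr : r ≤ m) (hs : s ≤ m)
    (h : (natFlag.{u} m).sub r = (natFlag.{u} m).sub s) : r = s := by
  rw [natFlag_sub hr, natFlag_sub hs] at h
  have e := Subobject.isoOfMkEqMk _ _ h
  exact le_antisymm (down_le_down_of_hom e.hom) (down_le_down_of_hom e.inv)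

/-- A natural transformation realizes at most one map. -/
theorem Realizes.map_unique {m n : ℕ} {a b : ℕ → ℕ} {η : iter.{u} m ⟶ iter n}
    (h : Realizes a η) (h' : Realizes b η) {r : ℕ} (hr : r ≤ n) (ha : a r ≤ m) (hb : b r ≤ m) :
    a r = b r := by
  obtain ⟨y, h1, -, h2⟩ := h.exists_flag (C := natCat) (natFlag m)
  obtain ⟨z, h3, -, h4⟩ := h'.exists_flag (C := natCat) (natFlag m)
  obtain rfl : y = z := Flag.toHom_injective_of_natCat (eq_of_heq (h1.symm.trans h3))
  exact natFlag_sub_injective ha hb ((h2 r hr).symm.trans (h4 r hr))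

end Separation

/-! ### The functor on the combinatorial category -/

section CombFunctor

/-- An order-preserving map between finite chains, as a map of natural numbers. It is extended
beyond the chain by its last value. -/
def extend {m n : ℕ} (a : Fin (n + 1) →o Fin (m + 1)) (r : ℕ) : ℕ :=
  a ⟨min r n, by omega⟩

theorem extend_apply {m n : ℕ} (a : Fin (n + 1) →o Fin (m + 1)) {r : ℕ} (h : r ≤ n) :
    extend a r = a ⟨r, by omega⟩ := by
  simp only [extend, min_eq_left h]

theorem extend_le {m n : ℕ} (a : Fin (n + 1) →o Fin (m + 1)) (r : ℕ) : extend a r ≤ m :=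
  Nat.le_of_lt_succ (Fin.is_lt _)

theorem monotone_extend {m n : ℕ} (a : Fin (n + 1) →o Fin (m + 1)) : Monotone (extend a) :=
  fun _ _ h => a.monotone (Fin.mk_le_mk.2 (min_le_min_right _ h))

theorem extend_comp {m n p : ℕ} (a : Fin (n + 1) →o Fin (m + 1)) (b : Fin (p + 1) →o Fin (n + 1))
    (r : ℕ) : extend a (extend b r) = extend (a.comp b) r :=
  extend_apply a (extend_le b r)

theorem Comb.exists_realizes {X Y : Comb} (a : X ⟶ Y) :
    ∃ η : iter.{u} X.n ⟶ iter Y.n, Realizes (extend a.1) η := by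
  refine Partialization.exists_realizes _ _ _ (monotone_extend a.1) ?_ ?_
  · rw [extend_apply _ (Nat.zero_le _)]
    exact congrArg Fin.val a.2.1
  · rw [extend_apply _ le_rfl]
    exact congrArg Fin.val a.2.2

/-- The natural transformation realizing a morphism of the combinatorial category. -/
noncomputable def Comb.realizer {X Y : Comb} (a : X ⟶ Y) : iter.{u} X.n ⟶ iter Y.n :=
  (Comb.exists_realizes a).choose

theorem Comb.realizes_realizer {X Y : Comb} (a : X ⟶ Y) :
    Realizes (extend a.1) (Comb.realizer.{u} a) :=
  (Comb.exists_realizes a).choose_spec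

theorem Comb.realizer_id (X : Comb) : Comb.realizer.{u} (𝟙 X) = 𝟙 _ :=
  (Comb.realizes_realizer _).unique ((realizes_id X.n).congr fun _ hr =>
    (extend_apply (OrderHom.id : Fin (X.n + 1) →o Fin (X.n + 1)) hr).symm)

theorem Comb.realizer_comp {X Y Z : Comb} (a : X ⟶ Y) (b : Y ⟶ Z) :
    Comb.realizer.{u} (a ≫ b) = Comb.realizer a ≫ Comb.realizer b :=
  (Comb.realizes_realizer _).unique (((Comb.realizes_realizer a).comp (Comb.realizes_realizer b)
    fun r _ => extend_le b.1 r).congr fun r _ => extend_comp a.1 b.1 r)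

theorem Comb.realizer_injective {X Y : Comb} {a b : X ⟶ Y}
    (h : Comb.realizer.{u} a = Comb.realizer b) : a = b := by
  refine Subtype.ext (OrderHom.ext _ _ (funext fun r => Fin.ext ?_))
  have hr : r.1 ≤ Y.n := Nat.le_of_lt_succ r.2
  have := (Comb.realizes_realizer.{u} a).map_unique (h ▸ Comb.realizes_realizer b) hr
    (extend_le _ _) (extend_le _ _)
  rwa [extend_apply _ hr, extend_apply _ hr] at this

theorem Comb.realizer_phi (n s : ℕ) (h1 : 1 ≤ s) (h2 : s ≤ n + 2) :
    Comb.realizer.{u} (Comb.phi n s h1 h2) = dupHom (n + 1) s :=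
  (Comb.realizes_realizer _).unique ((realizes_dupHom h2).congr fun _ hr =>
    (extend_apply (phiMap n s h2) hr).symm)

theorem Comb.realizer_tau (n s : ℕ) (h1 : 2 ≤ s) (h2 : s ≤ n + 2) :
    Comb.realizer.{u} (Comb.tau n s h1 h2) = skipHom n s :=
  (Comb.realizes_realizer _).unique ((realizes_skipHom h1 h2).congr fun _ hr =>
    (extend_apply (tauMap n s) hr).symm)

/-- The functor from the combinatorial category to the category of iterates which sends a map to
the natural transformation realizing it. -/
noncomputable def Comb.toIterates : Comb ⥤ Iterates.{u} where
  obj X := Iterates.of X.n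
  map a := Iterates.ofHom (Comb.realizer a)
  map_id X := by rw [Comb.realizer_id]; rfl
  map_comp a b := by rw [Comb.realizer_comp]; rfl

/-- The endomorphism monoid of `n` in the combinatorial category is the opposite of the monoid of
order-preserving maps fixing the endpoints. -/
def Comb.endEquiv (X : Comb) : End X ≃* (fixedEnds X.n)ᵐᵒᵖ where
  toFun a := MulOpposite.op ⟨a.1, a.2⟩
  invFun a := ⟨a.unop.1, a.unop.2⟩
  left_inv _ := rfl
  right_inv _ := rfl
  map_mul' _ _ := rfl

theorem obj_realizer (X : Comb) (a : End X) (C : PCat.{u}) (i : (iter X.n).obj C) :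
    ((Comb.realizer.{u} a).app C).toFunctor.obj i = i := by
  obtain ⟨i, rfl⟩ := iterObj_surjective C X.n i
  exact (Comb.realizes_realizer a).preservesIncl.obj_iterObj C i

/-- A functor which fixes an object acts on the endomorphism monoid of the object. -/
def endMap {D : Type u} [Category.{u} D] (F : D ⥤ D) {i : D} (h : F.obj i = i) :
    Monoid.End (End i) where
  toFun x := eqToHom h.symm ≫ F.map x ≫ eqToHom h
  map_one' := by
    change eqToHom h.symm ≫ F.map (𝟙 i) ≫ eqToHom h = 𝟙 i
    simp
  map_mul' x y := by
    change eqToHom h.symm ≫ F.map (y ≫ x) ≫ eqToHom h =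
      (eqToHom h.symm ≫ F.map y ≫ eqToHom h) ≫ (eqToHom h.symm ≫ F.map x ≫ eqToHom h)
    simp

theorem endMap_id {D : Type u} [Category.{u} D] {F : D ⥤ D} {i : D} (h : F.obj i = i)
    (hF : F = 𝟭 D) : endMap F h = 1 := by
  subst hF
  refine MonoidHom.ext fun x => ?_
  change 𝟙 i ≫ x ≫ 𝟙 i = x
  simp

theorem endMap_comp {D : Type u} [Category.{u} D] {F G H : D ⥤ D} {i : D} (hF : F.obj i = i)
    (hG : G.obj i = i) (hH : H.obj i = i) (h : H = G ⋙ F) :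
    endMap H hH = endMap F hF * endMap G hG := by
  subst h
  refine MonoidHom.ext fun x => ?_
  change eqToHom _ ≫ F.map (G.map x) ≫ eqToHom _ =
    eqToHom _ ≫ F.map (eqToHom _ ≫ G.map x ≫ eqToHom _) ≫ eqToHom _
  simp [eqToHom_map]

/-- The action of the endomorphisms of `n` in the combinatorial category on the endomorphisms of
an object of an `n`-fold partialization. -/
noncomputable def Comb.endAction (X : Comb) (C : PCat.{u}) (i : (iter X.n).obj C) :
    End X →* Monoid.End (End i) where
  toFun a := endMap ((Comb.realizer a).app C).toFunctor (obj_realizer X a C i)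
  map_one' := endMap_id _
    (congrArg (fun η : iter.{u} X.n ⟶ iter X.n => (NatTrans.app η C).toFunctor)
      (Comb.realizer_id X))
  map_mul' a b := endMap_comp _ _ _
    (congrArg (fun η : iter.{u} X.n ⟶ iter X.n => (NatTrans.app η C).toFunctor)
      (Comb.realizer_comp b a))

end CombFunctor

end Partialization

theorem mainTheorem7 :
    ∃ (f : ∀ n s : ℕ, 1 ≤ s → s ≤ n + 2 → (iter.{u} (n + 1) ⟶ iter.{u} (n + 2)))
      (t : ∀ n s : ℕ, 2 ≤ s → s ≤ n + 2 → (iter.{u} (n + 2) ⟶ iter.{u} (n + 1))),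
      (∀ n s h1 h2, ActsBy (f n s h1 h2) (fun _ _ _ x => x.dup s)) ∧
      (∀ n s h1 h2, ActsBy (t n s h1 h2) (fun _ _ _ x => x.skip s)) ∧
      ∃ (F : Comb ⥤ Iterates.{u}) (hF : ∀ X : Comb, F.obj X = Iterates.of X.n),
        (∀ n s h1 h2, F.map (Comb.phi n s h1 h2) =
          eqToHom (hF _) ≫ Iterates.ofHom (f n s h1 h2) ≫ eqToHom (hF _).symm) ∧
        (∀ n s h1 h2, F.map (Comb.tau n s h1 h2) =
          eqToHom (hF _) ≫ Iterates.ofHom (t n s h1 h2) ≫ eqToHom (hF _).symm) ∧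
        F.Faithful ∧
        ∀ X : Comb, ∃ e : End X ≃* (fixedEnds X.n)ᵐᵒᵖ,
          (∀ a : End X, ((e a).unop : Fin (X.n + 1) →o Fin (X.n + 1)) = a.1) ∧
          ∀ (C : PCat.{u}) (i : (iter X.n).obj C),
            ∃ ρ : (fixedEnds X.n)ᵐᵒᵖ →* Monoid.End (End i),
              ∀ a : End X, ∃ (η : iter.{u} X.n ⟶ iter.{u} X.n)
                (hi : (η.app C).toFunctor.obj i = i),
                F.map a = eqToHom (hF X) ≫ Iterates.ofHom η ≫ eqToHom (hF X).symm ∧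
                ∀ x : End i, ρ (e a) x =
                  eqToHom hi.symm ≫ (η.app C).toFunctor.map x ≫ eqToHom hi := by
  -- As `F` sends `X` to `Iterates.of X.n` by definition, the transports in the claim are trivial.
  have conj : ∀ {m n : ℕ} (η : iter.{u} m ⟶ iter n), Iterates.ofHom η =
      eqToHom (rfl : Iterates.of m = Iterates.of m) ≫ Iterates.ofHom η ≫
        eqToHom (rfl : Iterates.of n = Iterates.of n) := fun η => by simp
  refine ⟨fun n s _ _ => dupHom (n + 1) s, fun n s _ _ => skipHom n s,
    fun n s _ _ => (preservesIncl_dupHom _ _).actsBy fun _ _ _ => sendsTo_dupHom s,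
    fun n s _ _ => (preservesIncl_skipHom _ _).actsBy fun _ _ _ => sendsTo_skipHom s,
    Comb.toIterates, fun _ => rfl, fun n s h1 h2 => ?_, fun n s h1 h2 => ?_,
    ⟨fun {X Y a b} h => ?_⟩,
    fun X => ⟨Comb.endEquiv X, fun _ => rfl, fun C i =>
      ⟨(Comb.endAction X C i).comp (Comb.endEquiv X).symm.toMonoidHom, fun a =>
        ⟨Comb.realizer a, obj_realizer X a C i, conj _, fun _ => rfl⟩⟩⟩⟩
  · exact (congrArg Iterates.ofHom (Comb.realizer_phi n s h1 h2)).trans (conj _)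
  · exact (congrArg Iterates.ofHom (Comb.realizer_tau n s h1 h2)).trans (conj _)
  · exact Comb.realizer_injective (congrArg InducedCategory.Hom.hom h)
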